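/- All graphs are finite, simple and undirected. For a graph $G=(V,E)$ and a linear ordering $v_1,\dots,v_n$ of $V$ ($n=|V|$), let $G_i=G[\{v_1,\dots,v_i\}]$. A set $M$ of vertices of a graph $H$ is a module of $H$ if any two vertices of $M$ have the same neighbours in $H$ outside $M$. The ordering is an independent module-sequence for $G$ if for every $2\le i\le n$ the set of neighbours of $v_i$ in $\{v_1,\dots,v_{i-1}\}$ is a module of $G_{i-1}$ and an independent set. $G$ is independent module-composed if it has an independent module-sequence. A Lex-BFS ordering is an order in which lexicographic breadth first search can visit the vertices: all labels are empty at first; for $j=1,\dots,n$ the search visits as $v_j$ some vertex whose label is lexicographically largest among the unvisited vertices (ties are broken arbitrarily) and appends the number $n-j+1$ to the label of each unvisited neighbour of $v_j$. Theorem. Let $G$ be an independent module-composed graph. Then every Lex-BFS ordering of $G$ is an independent module-sequence for $G$, and Lex-BFS orderings are computed in time $O(|V|+|E|)$. That is, there are a single program of a unit-cost random access machine (with successor, predecessor, comparison, and indexed access to arrays) and a constant $c$ such that, for every independent module-composed graph $G$: 1. every Lex-BFS ordering of $G$ is an independent module-sequence for $G$; 2. for every numbering of the vertices by $0,\dots,n-1$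 and all adjacency lists of $G$ (each in any order) as input, the program halts after at most $c\,(|V|+|E|+1)$ steps and outputs a Lex-BFS ordering of $G$ (hence, by 1, an independent module-sequence); 3. every Lex-BFS ordering of $G$ is the output of the program, within the same time bound, for some numbering of the vertices and some order of the adjacency lists. -/

import Mathlib

namespace ModuleComposed

section Graphs

variable {V : Type*}

/-- `M` is a module (homogeneous set) of `G`: any two elements of `M` have the same
neighbours outside `M`. -/
def IsModule (G : SimpleGraph V) (M : Set V) : Prop :=
  ∀ v₁ ∈ M, ∀ v₂ ∈ M, G.neighborSet v₁ \ M = G.neighborSet v₂ \ M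

variable [Fintype V]

/-- Linear orderings of the vertices, with positions `0, …, |V| - 1`. -/
abbrev Ordering (V : Type*) [Fintype V] : Type _ := V ≃ Fin (Fintype.card V)

/-- The set of the vertices at the positions before `i`. -/
def before (φ : Ordering V) (i : Fin (Fintype.card V)) : Set V := {w | φ w < i}

/-- The neighbourhood of the vertex at position `i` among the vertices before it,
as a vertex set of the subgraph that these induce. -/
def earlierNbhd (G : SimpleGraph V) (φ : Ordering V) (i : Fin (Fintype.card V)) :
    Set (before φ i) :=
  {w | G.Adj (φ.symm i) w}

/-- Independent module-sequences: the neighbourhood of each vertex but the first, in the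
subgraph induced by the preceding vertices, is a module of that subgraph and an independent
set. -/
def IsIndependentModuleSequence (G : SimpleGraph V) (φ : Ordering V) : Prop :=
  ∀ i : Fin (Fintype.card V), 1 ≤ (i : ℕ) →
    IsModule (G.induce (before φ i)) (earlierNbhd G φ i) ∧
      (G.induce (before φ i)).IsIndepSet (earlierNbhd G φ i)

def IsIndependentModuleComposed (G : SimpleGraph V) : Prop :=
  ∃ φ : Ordering V, IsIndependentModuleSequence G φ

open Classical in
/-- The label of `w` in lexicographic breadth first search when the vertices at the positions
before `i` have been visited: the vertex visited at position `j` (from `0`) gets the number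
`|V| - j`, and this number is appended to the label of each of its neighbours. -/
noncomputable def lexLabel (G : SimpleGraph V) (φ : Ordering V) (i : Fin (Fintype.card V))
    (w : V) : List ℕ :=
  ((List.finRange (Fintype.card V)).filter
    (fun j => j < i ∧ G.Adj (φ.symm j) w)).map (fun j => Fintype.card V - (j : ℕ))

/-- `φ` is an order in which lexicographic breadth first search can visit the vertices: each
visited vertex has a lexicographically largest label among the vertices that are not yet
visited. Lists of numbers are compared lexicographically, a proper prefix being smaller. -/
def IsLexBFSOrdering (G : SimpleGraph V) (φ : Ordering V) : Prop :=
  ∀ v w : V, φ v ≤ φ w → lexLabel G φ (φ v) w ≤ lexLabel G φ (φ v) v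

/-- `L` gives for every vertex a list of its neighbours, in any order, without repetition. -/
def IsAdjacencyLists (G : SimpleGraph V) (L : V → List V) : Prop :=
  ∀ v, (L v).Nodup ∧ ∀ w, w ∈ L v ↔ G.Adj v w

end Graphs

/-! A random access machine with unit costs. Its memory consists of variables and arrays that
hold natural numbers. A program uses finitely many variables and arrays. The arithmetic is
limited to successor and predecessor, so that a step raises the largest number in memory by at
most one (up to the constants in the program). -/

structure State where
  var : ℕ → ℕ
  arr : ℕ → ℕ → ℕ

def State.setVar (s : State) (x k : ℕ) : State :=
  { s with var := Function.update s.var x k }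

def State.setArr (s : State) (a i k : ℕ) : State :=
  { s with arr := Function.update s.arr a (Function.update (s.arr a) i k) }

/-- Comparisons of two variables. -/
inductive Test where
  | eq (x y : ℕ)
  | lt (x y : ℕ)

def Test.Holds : Test → State → Prop
  | .eq x y, s => s.var x = s.var y
  | .lt x y, s => s.var x < s.var y

/-- Programs; `x`, `y` are names of variables and `a` is the name of an array. -/
inductive Program where
  | skip
  | const (x k : ℕ)
  | copy (x y : ℕ)
  | succ (x y : ℕ)
  | pred (x y : ℕ)
  | load (x a y : ℕ)
  | store (a x y : ℕ)
  | seq (p q : Program)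
  | ite (b : Test) (p q : Program)
  | loop (b : Test) (p : Program)

/-- `Exec p s s' t`: started in state `s`, the program `p` halts in state `s'` after exactly
`t` steps. Each elementary command and each evaluation of a test takes one step. -/
inductive Exec : Program → State → State → ℕ → Prop
  | skip (s : State) : Exec .skip s s 1
  | const (s : State) (x k : ℕ) : Exec (.const x k) s (s.setVar x k) 1
  | copy (s : State) (x y : ℕ) : Exec (.copy x y) s (s.setVar x (s.var y)) 1
  | succ (s : State) (x y : ℕ) : Exec (.succ x y) s (s.setVar x (s.var y + 1)) 1
  | pred (s : State) (x y : ℕ) : Exec (.pred x y) s (s.setVar x (s.var y - 1)) 1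
  | load (s : State) (x a y : ℕ) : Exec (.load x a y) s (s.setVar x (s.arr a (s.var y))) 1
  | store (s : State) (a x y : ℕ) :
      Exec (.store a x y) s (s.setArr a (s.var x) (s.var y)) 1
  | seq {p q : Program} {s₁ s₂ s₃ : State} {t u : ℕ} :
      Exec p s₁ s₂ t → Exec q s₂ s₃ u → Exec (.seq p q) s₁ s₃ (t + u)
  | ite_true {b : Test} {p q : Program} {s₁ s₂ : State} {t : ℕ} :
      b.Holds s₁ → Exec p s₁ s₂ t → Exec (.ite b p q) s₁ s₂ (t + 1)
  | ite_false {b : Test} {p q : Program} {s₁ s₂ : State} {t : ℕ} :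
      ¬ b.Holds s₁ → Exec q s₁ s₂ t → Exec (.ite b p q) s₁ s₂ (t + 1)
  | loop_true {b : Test} {p : Program} {s₁ s₂ s₃ : State} {t u : ℕ} :
      b.Holds s₁ → Exec p s₁ s₂ t → Exec (.loop b p) s₂ s₃ u →
        Exec (.loop b p) s₁ s₃ (t + u + 1)
  | loop_false {b : Test} {p : Program} {s : State} :
      ¬ b.Holds s → Exec (.loop b p) s s 1

section InputOutput

variable {V : Type*} [Fintype V]

/-- The adjacency lists `L` with the vertices replaced by their numbers, in the order of the
numbering `e`. -/
def numberedLists (e : Ordering V) (L : V → List V) : List (List ℕ) :=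
  List.ofFn fun i => (L (e.symm i)).map fun w => (e w : ℕ)

/-- The input: variable `0` holds the number of vertices, array `1` holds the adjacency lists
one after the other, and entry `i` of array `0` is the index at which the list of the vertex
number `i` begins in array `1` (for `i = |V|`, the index after the last list). All other cells
are `0`. -/
def inputState (e : Ordering V) (L : V → List V) : State where
  var x := if x = 0 then Fintype.card V else 0
  arr a i :=
    if a = 0 then (if i ≤ Fintype.card V then ((numberedLists e L).take i).flatten.length else 0)
    else if a = 1 then (numberedLists e L).flatten.getD i 0
    else 0

/-- With the numbering `e` and the adjacency lists `L` as input, `p` halts after at most `T`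
steps, and array `2` then lists the numbers of the vertices in the order `φ`. -/
def ComputesWithin (p : Program) (e : Ordering V) (L : V → List V) (φ : Ordering V)
    (T : ℕ) : Prop :=
  ∃ (s : State) (t : ℕ), Exec p (inputState e L) s t ∧ t ≤ T ∧
    ∀ i : Fin (Fintype.card V), s.arr 2 (i : ℕ) = (e (φ.symm i) : ℕ)

end InputOutput

end ModuleComposed

/-! Independent module-sequences are handled as injective ranks (`IsModuleRank`): the earlier
neighbours of a vertex `s` are pairwise nonadjacent and agree on the earlier non-neighbours of `s`.
Looking at the last vertex of a configuration excludes triangles and dominos, and also cycles that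
are closed through a connected set `S` without certain chords (`no_path_cycle`, `no_edge_cycle`).
For these, the last vertex of `S` is deleted unless it already gives a contradiction.

Of Lex-BFS only the four-point property `IsLexBFSRank` is used. Joining each vertex to its first
neighbour, if that is earlier, gives a forest whose levels behave like distances in breadth first
search. No edge lies within a level (`level_ne`), and two vertices with a common neighbour one level
further have the same neighbours one level nearer to the root (`adj_of_common`): otherwise a
forbidden cycle would close through the levels nearer to the root, or a domino would appear. If the
Lex-BFS ordering violated the module condition at `v`, then either `adj_of_common` would fail, or
the four-point property would supply the sixth vertex of a domino (`IsLexBFSRank.isModuleRank`).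

The program is partition refinement. The unvisited vertices are kept in decreasing order of their
labels, and those with equal labels form a class, which occupies an interval. Visiting a vertex
moves each unvisited neighbour, by one swap with the first vertex of its class, into a class split
off in front. This takes constant time per list entry, hence linear time in total. Labels are
compared as binary numbers (`lexValue`). To output a given Lex-BFS ordering `φ`, number the vertices
along `φ` and sort the lists: each neighbour to be moved is then already first in its class, so
every swap is trivial. -/

namespace ModuleComposed

/-! ### Forbidden configurations in independent module-composed graphs. -/

section ModuleRank

variable {V : Type*} {G : SimpleGraph V} {f : V → ℕ}

/-- The ordering by `f` is an independent module-sequence, in a form that passes to induced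
subgraphs. -/
def IsModuleRank (G : SimpleGraph V) (f : V → ℕ) : Prop :=
  Function.Injective f ∧ ∀ s a b, f a < f s → f b < f s → G.Adj s a → G.Adj s b →
    ¬ G.Adj a b ∧ ∀ c, f c < f s → ¬ G.Adj s c → G.Adj a c → G.Adj b c

theorem IsModuleRank.lt_of_le (hf : IsModuleRank G f) {a b : V} (h : f a ≤ f b) (hn : a ≠ b) :
    f a < f b :=
  lt_of_le_of_ne h fun h' => hn (hf.1 h')

/-- The last vertex of a triangle would have two adjacent earlier neighbours. -/
theorem IsModuleRank.triangle_free (hf : IsModuleRank G f) {a b c : V} (hab : G.Adj a b)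
    (hbc : G.Adj b c) (hac : G.Adj a c) : False := by
  have key : ∀ a b c : V, G.Adj a b → G.Adj b c → G.Adj a c → f b ≤ f a → f c ≤ f a → False :=
    fun a b c hab hbc hac h₁ h₂ =>
      (hf.2 a b c (hf.lt_of_le h₁ hab.ne') (hf.lt_of_le h₂ hac.ne') hab hac).1 hbc
  rcases le_total (f a) (f b) with h₁ | h₁ <;> rcases le_total (f b) (f c) with h₂ | h₂ <;>
    rcases le_total (f a) (f c) with h₃ | h₃
  · exact key c a b hac.symm hab hbc.symm h₃ h₂
  · exact key c a b hac.symm hab hbc.symm (h₁.trans h₂) h₂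
  · exact key b a c hab.symm hac hbc h₁ h₂
  · exact key b a c hab.symm hac hbc h₁ h₂
  · exact key c a b hac.symm hab hbc.symm h₃ h₂
  · exact key a b c hab hbc hac h₁ h₃
  · exact key a b c hab hbc hac h₁ (h₂.trans h₁)
  · exact key a b c hab hbc hac h₁ h₃

/-- There is no induced domino: a cycle `w a z x v b` with the chord `w x` only. -/
theorem IsModuleRank.domino_free (hf : IsModuleRank G f) {w a z x v b : V}
    (hwa : G.Adj w a) (haz : G.Adj a z) (hzx : G.Adj z x) (hxv : G.Adj x v) (hvb : G.Adj v b)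
    (hbw : G.Adj b w) (hwx : G.Adj w x) (hav : ¬ G.Adj a v) (hbz : ¬ G.Adj b z)
    (hab : ¬ G.Adj a b) (hzv : ¬ G.Adj z v) : False := by
  have hwz : ¬ G.Adj w z := fun h => hf.triangle_free hwa haz h
  have hwv : ¬ G.Adj w v := fun h => hf.triangle_free hwx hxv h
  have hax : ¬ G.Adj a x := fun h => hf.triangle_free haz hzx h
  have hbx : ¬ G.Adj b x := fun h => hf.triangle_free hvb.symm hxv.symm h
  classical
  -- the last vertex has degree two
  have side : ∀ {w a z x v b : V}, G.Adj w a → G.Adj a z → G.Adj z x → G.Adj x v →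
      G.Adj v b → G.Adj b w → G.Adj w x → ¬ G.Adj a v → ¬ G.Adj a b →
      ¬ G.Adj a x → ¬ G.Adj z v → ¬ G.Adj b z →
      f w ≤ f a → f z ≤ f a → f x ≤ f a → f v ≤ f a → f b ≤ f a → False := by
    intro w a z x v b hwa haz hzx hxv hvb hbw hwx hav hab hax hzv hbz h1 h2 h3 h4 h5
    have hne : b ≠ a := by rintro rfl; exact hbz haz
    exact hbz ((hf.2 a w z (hf.lt_of_le h1 hwa.ne) (hf.lt_of_le h2 haz.ne') hwa.symm haz).2 b
      (hf.lt_of_le h5 hne) hab hbw.symm).symm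
  -- the last vertex has degree three
  have mid : ∀ {w a z x v b : V}, G.Adj w a → G.Adj a z → G.Adj z x → G.Adj x v →
      G.Adj v b → G.Adj b w → G.Adj w x → ¬ G.Adj b z → ¬ G.Adj w z →
      f a ≤ f w → f z ≤ f w → f b ≤ f w → False := by
    intro w a z x v b hwa haz hzx hxv hvb hbw hwx hbz hwz h1 h2 h3
    have hne : z ≠ w := by rintro rfl; exact hbz hbw
    exact hbz ((hf.2 w a b (hf.lt_of_le h1 hwa.ne') (hf.lt_of_le h3 hbw.ne) hwa hbw.symm).2 z
      (hf.lt_of_le h2 hne) hwz haz)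
  obtain ⟨m, hm, hmax⟩ := Finset.exists_max_image ({w, a, z, x, v, b} : Finset V) f ⟨w, by simp⟩
  simp only [Finset.mem_insert, Finset.mem_singleton, forall_eq_or_imp, forall_eq] at hm hmax
  obtain ⟨m1, m2, m3, m4, m5, m6⟩ := hmax
  have sy : ∀ {p q : V}, ¬ G.Adj p q → ¬ G.Adj q p := fun h h' => h h'.symm
  -- The symmetries of the domino reduce the last vertex to `w` (also covering `x`) or `a` (also
  -- covering `z`, `v`, `b`).
  rcases hm with rfl | rfl | rfl | rfl | rfl | rfl
  · exact mid hwa haz hzx hxv hvb hbw hwx hbz hwz m2 m3 m6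
  · exact side hwa haz hzx hxv hvb hbw hwx hav hab hax hzv hbz m1 m3 m4 m5 m6
  · exact side hzx.symm haz.symm hwa.symm hbw.symm hvb.symm hxv.symm hwx.symm (sy hbz) hzv
      (sy hwz) hab (sy hav) m4 m2 m1 m6 m5
  · exact mid hzx.symm haz.symm hwa.symm hbw.symm hvb.symm hxv.symm hwx.symm
      (sy hav) (sy hax) m3 m2 m5
  · exact side hxv hvb hbw hwa haz hzx hwx.symm (sy hav) (sy hzv) (sy hwv) (sy hab) (sy hbz)
      m4 m6 m1 m2 m3
  · exact side hbw.symm hvb.symm hxv.symm hzx.symm haz.symm hwa.symm hwx hbz (sy hab) hbx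
      (sy hzv) hav m1 m5 m4 m3 m2

/-- The subgraph induced by `S` is connected or empty. -/
def ConnectedOn (G : SimpleGraph V) (S : Finset V) : Prop :=
  ∀ T : Set V, T.Nonempty → T ⊆ S → (∀ a ∈ T, ∀ b ∈ S, G.Adj a b → b ∈ T) → (S : Set V) ⊆ T

/-- If a neighbour of `s` in `S` has another neighbour `c` in `S`, then `c` is not adjacent to `s`,
so the module condition joins all neighbours of `s` in `S` to `c`, and paths through `s` can be
rerouted through `c`. If there is no such `c`, then `s` and its neighbours exhaust `S`. -/
theorem IsModuleRank.connectedOn_erase [DecidableEq V] (hf : IsModuleRank G f) {S : Finset V}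
    (hS : ConnectedOn G S) {s : V} (hs : s ∈ S) (hmax : ∀ t ∈ S, f t ≤ f s) :
    ConnectedOn G (S.erase s) ∨ ∀ t ∈ S, t = s ∨ G.Adj s t := by
  by_cases H : ∃ a ∈ S, G.Adj s a ∧ ∃ c ∈ S, c ≠ s ∧ G.Adj a c
  · obtain ⟨a, ha, hsa, c, hc, hcs, hac⟩ := H
    have hlt : ∀ t ∈ S, t ≠ s → f t < f s := fun t ht h => hf.lt_of_le (hmax t ht) h
    have hsc : ¬ G.Adj s c := fun h => hf.triangle_free hsa hac h
    have hcom : ∀ b ∈ S, G.Adj s b → G.Adj b c := fun b hb hsb =>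
      (hf.2 s a b (hlt a ha hsa.ne') (hlt b hb hsb.ne') hsa hsb).2 c (hlt c hc hcs) hsc hac
    left
    intro T hne hT hcl
    have hT' : ∀ t ∈ T, t ≠ s ∧ t ∈ S := fun t ht => by simpa [and_comm] using hT ht
    by_cases hb : ∃ b ∈ T, G.Adj s b
    · obtain ⟨b, hb, hsb⟩ := hb
      have hcT : c ∈ T := hcl b hb c (by simp [hc, hcs]) (hcom b (hT' b hb).2 hsb)
      have hnb : ∀ t ∈ S, G.Adj s t → t ∈ T := fun t ht hst =>
        hcl c hcT t (by simp [ht, hst.ne']) (hcom t ht hst).symm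
      have := hS (insert s T) ⟨s, by simp⟩
        (by intro t ht; rcases ht with rfl | ht; exacts [hs, (hT' t ht).2])
        (by
          intro p hp q hq hpq
          by_cases hqs : q = s
          · exact Or.inl hqs
          rcases hp with rfl | hp
          · exact Or.inr (hnb q hq hpq)
          · exact Or.inr (hcl p hp q (by simp [hq, hqs]) hpq))
      intro t ht
      have ht' : t ≠ s ∧ t ∈ S := by simpa [and_comm] using ht
      exact (this ht'.2).resolve_left ht'.1
    · exfalso
      push Not at hb
      have := hS T hne (fun t ht => (hT' t ht).2)
        (by
          intro p hp q hq hpq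
          by_cases hqs : q = s
          · exact absurd (hqs ▸ hpq.symm) (hb p hp)
          · exact hcl p hp q (by simp [hq, hqs]) hpq)
      exact (hT' s (this hs)).1 rfl
  · push Not at H
    right
    intro t ht
    exact hS {t | t ∈ S ∧ (t = s ∨ G.Adj s t)} ⟨s, hs, Or.inl rfl⟩ (fun t ht => ht.1)
      (by
        rintro p ⟨hp, hps⟩ q hq hpq
        refine ⟨hq, ?_⟩
        by_cases hqs : q = s
        · exact Or.inl hqs
        rcases hps with rfl | hps
        · exact Or.inr hpq
        · exact absurd hpq (H p hp hps q hq hqs)) ht |>.2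

theorem ConnectedOn.exists_adj {S : Finset V} (hS : ConnectedOn G S) {s t : V} (hs : s ∈ S)
    (ht : t ∈ S) (h : t ≠ s) : ∃ u ∈ S, G.Adj s u := by
  by_contra! H
  exact h (hS {s} ⟨s, rfl⟩ (by simpa using hs)
    (by rintro p rfl q hq hpq; exact absurd hpq (H q hq)) ht)

/-- No cycle through the path `x v y` whose part outside has no chords to that path. -/
theorem IsModuleRank.no_path_cycle (hf : IsModuleRank G f) {v x y : V} (hvx : G.Adj v x)
    (hvy : G.Adj v y) : ∀ S : Finset V, ConnectedOn G S → v ∉ S → x ∉ S → y ∉ S →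
    (∀ t ∈ S, ¬ G.Adj v t) → (∃ t ∈ S, G.Adj x t) → (∃ t ∈ S, G.Adj y t) →
    (∀ t ∈ S, G.Adj x t → ¬ G.Adj y t) → False := by
  classical
  intro S
  induction S using Finset.strongInduction with
  | H S ih =>
  intro hS hv hx hy hvS hxS hyS hd
  have hxy : ¬ G.Adj x y := fun h => hf.triangle_free hvx h hvy
  obtain ⟨z, hz, hxz⟩ := hxS
  obtain ⟨p, hp, hyp⟩ := hyS
  have hyz := hd z hz hxz
  have hxp : ¬ G.Adj x p := fun h => hd p hp h hyp
  have hne : x ≠ y := by rintro rfl; exact hyz hxz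
  obtain ⟨m, hm, hmax⟩ := Finset.exists_max_image (insert v (insert x (insert y S))) f
    ⟨v, by simp⟩
  simp only [Finset.mem_insert, forall_eq_or_imp] at hm hmax
  obtain ⟨mv, mx, my, mS⟩ := hmax
  have ne_of : ∀ {a b : V}, a ∈ S → b ∉ S → a ≠ b := fun h h' e => h' (e ▸ h)
  rcases hm with rfl | rfl | rfl | hm
  · exact hyz ((hf.2 m x y (hf.lt_of_le mx hvx.ne') (hf.lt_of_le my hvy.ne') hvx hvy).2 z
      (hf.lt_of_le (mS z hz) (ne_of hz hv)) (hvS z hz) hxz)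
  · exact hyz ((hf.2 m v z (hf.lt_of_le mv hvx.ne) (hf.lt_of_le (mS z hz) hxz.ne')
      hvx.symm hxz).2 y (hf.lt_of_le my hne.symm) hxy hvy).symm
  · exact hxp ((hf.2 m v p (hf.lt_of_le mv hvy.ne) (hf.lt_of_le (mS p hp) hyp.ne')
      hvy.symm hyp).2 x (hf.lt_of_le mx hne) (fun h => hxy h.symm) hvx).symm
  -- A last vertex `m` of `S` adjacent to `x` has a neighbour `u` in `S`. The module condition at
  -- `m`, applied to `x` and `u`, carries the adjacency of `v` from `x` to `u`, although `v` has no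
  -- neighbour in `S`.
  · have near : ∀ x y z : V, G.Adj v x → x ∉ S → z ∈ S → G.Adj y z → ¬ G.Adj y m →
        G.Adj x m → f x ≤ f m → False := by
      intro x y z hvx hx hz hyz hym hxm mx
      obtain ⟨u, hu, hmu⟩ := hS.exists_adj hm hz (by rintro rfl; exact hym hyz)
      exact hvS u hu ((hf.2 m x u (hf.lt_of_le mx hxm.ne) (hf.lt_of_le (mS u hu) hmu.ne')
        hxm.symm hmu).2 v (hf.lt_of_le mv (ne_of hm hv).symm) (fun h => hvS m hm h.symm)
        hvx.symm).symm
    by_cases hxm : G.Adj x m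
    · exact near x y p hvx hx hp hyp (hd m hm hxm) hxm mx
    by_cases hym : G.Adj y m
    · exact near y x z hvy hy hz hxz hxm hym my
    have hzm : z ≠ m := by rintro rfl; exact hxm hxz
    have hpm : p ≠ m := by rintro rfl; exact hym hyp
    -- Now `m` is adjacent to neither `x` nor `y`, so it can be deleted. If deletion might
    -- disconnect `S`, then `m` is adjacent to both `z` and `p`, and `x` would have to see both or
    -- neither.
    rcases hf.connectedOn_erase hS hm mS with h | h
    · exact ih (S.erase m) (Finset.erase_ssubset hm) h (by simp [hv]) (by simp [hx])
        (by simp [hy]) (fun t ht => hvS t (Finset.mem_of_mem_erase ht))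
        ⟨z, by simp [hz, hzm], hxz⟩ ⟨p, by simp [hp, hpm], hyp⟩
        (fun t ht => hd t (Finset.mem_of_mem_erase ht))
    · exact hxp ((hf.2 m z p (hf.lt_of_le (mS z hz) hzm) (hf.lt_of_le (mS p hp) hpm)
        ((h z hz).resolve_left hzm) ((h p hp).resolve_left hpm)).2 x
        (hf.lt_of_le mx (ne_of hm hx).symm) (fun h => hxm h.symm) hxz.symm).symm

/-- No cycle of length at least five through the edge `x y` that has no chords at `x` and `y`
and no chord between their other neighbours. -/
theorem IsModuleRank.no_edge_cycle (hf : IsModuleRank G f) {x y : V} (hxy : G.Adj x y) :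
    ∀ S : Finset V, ConnectedOn G S → x ∉ S → y ∉ S →
    (∃ t ∈ S, G.Adj x t) → (∃ t ∈ S, G.Adj y t) →
    (∀ t ∈ S, ∀ u ∈ S, G.Adj x t → G.Adj y u → ¬ G.Adj t u) → False := by
  classical
  intro S
  induction S using Finset.strongInduction with
  | H S ih =>
  intro hS hx hy hxS hyS hd
  obtain ⟨z, hz, hxz⟩ := hxS
  obtain ⟨p, hp, hyp⟩ := hyS
  have hzp := hd z hz p hp hxz hyp
  have hyz : ¬ G.Adj y z := fun h => hf.triangle_free hxy h hxz
  have hxp : ¬ G.Adj x p := fun h => hf.triangle_free hxy hyp h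
  obtain ⟨m, hm, hmax⟩ := Finset.exists_max_image (insert x (insert y S)) f ⟨x, by simp⟩
  simp only [Finset.mem_insert, forall_eq_or_imp] at hm hmax
  obtain ⟨mx, my, mS⟩ := hmax
  have ne_of : ∀ {a b : V}, a ∈ S → b ∉ S → a ≠ b := fun h h' e => h' (e ▸ h)
  rcases hm with rfl | rfl | hm
  · exact hzp ((hf.2 m y z (hf.lt_of_le my hxy.ne') (hf.lt_of_le (mS z hz) hxz.ne')
      hxy hxz).2 p (hf.lt_of_le (mS p hp) (ne_of hp hx)) hxp hyp)
  · exact hzp ((hf.2 m x p (hf.lt_of_le mx hxy.ne) (hf.lt_of_le (mS p hp) hyp.ne')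
      hxy.symm hyp).2 z (hf.lt_of_le (mS z hz) (ne_of hz hy)) hyz hxz).symm
  -- Here the module condition at `m` makes `u` a neighbour of `y`, so that `m u` is a forbidden
  -- edge between a neighbour of `x` and a neighbour of `y`.
  · have near : ∀ x y z : V, G.Adj x y → x ∉ S → y ∉ S → z ∈ S → G.Adj y z →
        (∀ t ∈ S, ∀ u ∈ S, G.Adj x t → G.Adj y u → ¬ G.Adj t u) →
        G.Adj x m → f x ≤ f m → f y ≤ f m → False := by
      intro x y z hxy hx hy hz hyz hd hxm mx my
      have hym : ¬ G.Adj y m := fun h => hf.triangle_free hxy h hxm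
      obtain ⟨u, hu, hmu⟩ := hS.exists_adj hm hz (by rintro rfl; exact hym hyz)
      exact hd m hm u hu hxm ((hf.2 m x u (hf.lt_of_le mx hxm.ne) (hf.lt_of_le (mS u hu) hmu.ne')
        hxm.symm hmu).2 y (hf.lt_of_le my (ne_of hm hy).symm) (fun h => hym h.symm)
        hxy).symm hmu
    by_cases hxm : G.Adj x m
    · exact near x y p hxy hx hy hp hyp hd hxm mx my
    by_cases hym : G.Adj y m
    · exact near y x z hxy.symm hy hx hz hxz
        (fun t ht u hu h₁ h₂ h₃ => hd u hu t ht h₂ h₁ h₃.symm) hym my mx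
    have hzm : z ≠ m := by rintro rfl; exact hxm hxz
    have hpm : p ≠ m := by rintro rfl; exact hym hyp
    rcases hf.connectedOn_erase hS hm mS with h | h
    · exact ih (S.erase m) (Finset.erase_ssubset hm) h (by simp [hx]) (by simp [hy])
        ⟨z, by simp [hz, hzm], hxz⟩ ⟨p, by simp [hp, hpm], hyp⟩
        (fun t ht u hu => hd t (Finset.mem_of_mem_erase ht) u (Finset.mem_of_mem_erase hu))
    · exact hxp ((hf.2 m z p (hf.lt_of_le (mS z hz) hzm) (hf.lt_of_le (mS p hp) hpm)
        ((h z hz).resolve_left hzm) ((h p hp).resolve_left hpm)).2 x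
        (hf.lt_of_le mx (ne_of hm hx).symm) (fun h => hxm h.symm) hxz.symm).symm

end ModuleRank

/-! ### Levels of the Lex-BFS forest and the module property. -/

section LexBFS

variable {V : Type*} {G : SimpleGraph V} {f g : V → ℕ}

/-- The four-point property of Lex-BFS orderings. -/
def IsLexBFSRank (G : SimpleGraph V) (g : V → ℕ) : Prop :=
  Function.Injective g ∧ ∀ a b c, g a < g b → g b < g c → G.Adj a c → ¬ G.Adj a b →
    ∃ d, g d < g a ∧ G.Adj d b ∧ ¬ G.Adj d c

/-- `p` is the first neighbour of `u`, and it precedes `u`. -/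
def IsParent (G : SimpleGraph V) (g : V → ℕ) (p u : V) : Prop :=
  g p < g u ∧ G.Adj p u ∧ ∀ w, G.Adj w u → g p ≤ g w

theorem exists_isParent {w u : V} (h : g w < g u) (hwu : G.Adj w u) :
    ∃ p, IsParent G g p u := by
  obtain ⟨p, hp, hmin⟩ := (measure g).wf.has_min {w | G.Adj w u} ⟨w, hwu⟩
  have hmin' : ∀ w, G.Adj w u → g p ≤ g w := fun w hw => not_lt.1 (hmin w hw)
  exact ⟨p, (hmin' w hwu).trans_lt h, hp, hmin'⟩

open Classical in
/-- The distance to the root of the search tree. -/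
noncomputable def level (G : SimpleGraph V) (g : V → ℕ) (u : V) : ℕ :=
  if h : ∃ p, IsParent G g p u then level G g h.choose + 1 else 0
termination_by g u
decreasing_by exact h.choose_spec.1

theorem level_of_not_exists {u : V} (h : ¬ ∃ p, IsParent G g p u) : level G g u = 0 := by
  rw [level, dif_neg h]

theorem IsLexBFSRank.level_of_isParent (hg : IsLexBFSRank G g) {p u : V}
    (h : IsParent G g p u) : level G g u = level G g p + 1 := by
  have hex : ∃ p, IsParent G g p u := ⟨p, h⟩
  have : hex.choose = p := hg.1 (le_antisymm (hex.choose_spec.2.2 p h.2.1)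
    (h.2.2 _ hex.choose_spec.2.1))
  rw [level, dif_pos hex, this]

/-- No search tree is begun after `a` up to `b`. -/
def SameTree (G : SimpleGraph V) (g : V → ℕ) (a b : V) : Prop :=
  ∀ t, g a < g t → g t ≤ g b → ∃ p, IsParent G g p t

theorem SameTree.mono {a b c d : V} (h : SameTree G g a b) (hac : g a ≤ g c)
    (hdb : g d ≤ g b) : SameTree G g c d :=
  fun t h₁ h₂ => h t (hac.trans_lt h₁) (h₂.trans hdb)

theorem SameTree.trans {a b c : V} (h : SameTree G g a b) (h' : SameTree G g b c) :
    SameTree G g a c := fun t h₁ h₂ => by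
  rcases le_or_gt (g t) (g b) with h₃ | h₃
  exacts [h t h₁ h₃, h' t h₃ h₂]

/-- The graph may be disconnected, so levels are comparable only within one tree; this is what
places adjacent vertices in the same tree. A vertex `t` between `a` and `b` that is not adjacent to
`a` gets an earlier neighbour from the four-point property. -/
theorem IsLexBFSRank.sameTree_of_adj (hg : IsLexBFSRank G g) {a b : V} (hab : G.Adj a b)
    (h : g a < g b) : SameTree G g a b := by
  intro t h₁ h₂
  rcases h₂.eq_or_lt with h₂ | h₂
  · obtain rfl := hg.1 h₂
    exact exists_isParent h₁ hab
  by_cases hat : G.Adj a t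
  · exact exists_isParent h₁ hat
  · obtain ⟨d, hd, hdt, -⟩ := hg.2 a t b h₁ h₂ hab hat
    exact exists_isParent (hd.trans h₁) hdt

/-- Parents come in the same order as their children: if the parent of `b` preceded the parent of
`a`, the four-point property would give `a` a neighbour before its first one. -/
theorem IsLexBFSRank.level_mono (hg : IsLexBFSRank G g) : ∀ {b a : V}, g a ≤ g b →
    SameTree G g a b → level G g a ≤ level G g b := by
  intro b
  induction b using (measure g).wf.induction with
  | _ b ih =>
  intro a hab h
  rcases hab.eq_or_lt with hab | hab
  · rw [hg.1 hab]
  by_cases ha : ∃ p, IsParent G g p a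
  swap
  · rw [level_of_not_exists ha]; exact Nat.zero_le _
  obtain ⟨p, hp⟩ := ha
  obtain ⟨q, hq⟩ := h b hab le_rfl
  rw [hg.level_of_isParent hp, hg.level_of_isParent hq]
  have hpq : g p ≤ g q := by
    by_contra! hlt
    have hqa : ¬ G.Adj q a := fun hqa => absurd (hp.2.2 q hqa) (not_le.2 hlt)
    obtain ⟨d, hd, hda, -⟩ := hg.2 q a b (hlt.trans hp.1) hab hq.2.1 hqa
    exact absurd (hp.2.2 d hda) (not_le.2 (hd.trans hlt))
  exact Nat.succ_le_succ (ih q hq.1 hpq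
    (((hg.sameTree_of_adj hp.2.1 hp.1).trans h).mono le_rfl hq.1.le))

theorem IsLexBFSRank.level_adj (hg : IsLexBFSRank G g) {a b : V} (hab : G.Adj a b)
    (h : g a < g b) : level G g a ≤ level G g b ∧ level G g b ≤ level G g a + 1 := by
  have hs := hg.sameTree_of_adj hab h
  refine ⟨hg.level_mono h.le hs, ?_⟩
  obtain ⟨p, hp⟩ := exists_isParent h hab
  rw [hg.level_of_isParent hp]
  exact Nat.succ_le_succ (hg.level_mono (hp.2.2 a hab)
    ((hg.sameTree_of_adj hp.2.1 hp.1).mono le_rfl h.le))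

theorem IsLexBFSRank.level_adj_le (hg : IsLexBFSRank G g) {a b : V} (hab : G.Adj a b) :
    level G g b ≤ level G g a + 1 := by
  rcases lt_trichotomy (g a) (g b) with h | h | h
  · exact (hg.level_adj hab h).2
  · rw [hg.1 h]; exact Nat.le_succ _
  · exact (hg.level_adj hab.symm h).1.trans (Nat.le_succ _)

theorem exists_isParent_of_level_pos {u : V} (h : 0 < level G g u) :
    ∃ p, IsParent G g p u := by
  by_contra hn
  rw [level_of_not_exists hn] at h
  exact absurd h (lt_irrefl _)

/-- `t` belongs to the search tree with root `r`. -/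
def InTree (G : SimpleGraph V) (g : V → ℕ) (r t : V) : Prop :=
  (¬ ∃ p, IsParent G g p r) ∧ g r ≤ g t ∧ SameTree G g r t

theorem IsLexBFSRank.inTree_of_adj (hg : IsLexBFSRank G g) {r t u : V} (h : InTree G g r t)
    (htu : G.Adj t u) : InTree G g r u := by
  rcases lt_trichotomy (g t) (g u) with hlt | heq | hlt
  · exact ⟨h.1, h.2.1.trans hlt.le, h.2.2.trans (hg.sameTree_of_adj htu hlt)⟩
  · exact absurd (hg.1 heq) htu.ne
  · refine ⟨h.1, ?_, h.2.2.mono le_rfl hlt.le⟩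
    by_contra! hur
    exact h.1 (hg.sameTree_of_adj htu.symm hlt r hur h.2.1)

theorem IsLexBFSRank.exists_inTree (hg : IsLexBFSRank G g) (u : V) : ∃ r, InTree G g r u := by
  induction u using (measure g).wf.induction with
  | _ u ih =>
  by_cases hu : ∃ p, IsParent G g p u
  · obtain ⟨p, hp⟩ := hu
    obtain ⟨r, hr⟩ := ih p hp.1
    exact ⟨r, hg.inTree_of_adj hr hp.2.1⟩
  · exact ⟨u, hu, le_rfl, fun t h₁ h₂ => absurd h₁ (not_lt.2 h₂)⟩

theorem InTree.eq_of_level_eq_zero (hg : IsLexBFSRank G g) {r t : V} (h : InTree G g r t)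
    (h0 : level G g t = 0) : t = r := by
  by_contra hne
  obtain ⟨p, hp⟩ := h.2.2 t (lt_of_le_of_ne h.2.1 fun h' => hne (hg.1 h').symm) le_rfl
  rw [hg.level_of_isParent hp] at h0
  exact absurd h0 (Nat.succ_ne_zero _)

open Classical in
/-- The vertices of the search tree with root `r` at the levels below `j`. -/
noncomputable def treeBelow [Fintype V] (G : SimpleGraph V) (g : V → ℕ) (r : V) (j : ℕ) :
    Finset V :=
  {t | InTree G g r t ∧ level G g t < j}

theorem mem_treeBelow [Fintype V] {r t : V} {j : ℕ} :
    t ∈ treeBelow G g r j ↔ InTree G g r t ∧ level G g t < j := by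
  simp [treeBelow]

/-- Repeatedly taking parents leads to `r` and never raises the level. -/
theorem IsLexBFSRank.connectedOn_treeBelow [Fintype V] (hg : IsLexBFSRank G g) (r : V) (j : ℕ) :
    ConnectedOn G (treeBelow G g r j) := by
  intro T hne hT hcl
  have hpar : ∀ t ∈ treeBelow G g r j, t ≠ r →
      ∃ p ∈ treeBelow G g r j, g p < g t ∧ G.Adj p t := by
    intro t ht hne
    obtain ⟨ht, hj⟩ := mem_treeBelow.1 ht
    obtain ⟨p, hp⟩ := ht.2.2 t (lt_of_le_of_ne ht.2.1 fun h' => hne (hg.1 h').symm) le_rfl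
    refine ⟨p, mem_treeBelow.2 ⟨hg.inTree_of_adj ht hp.2.1.symm, ?_⟩, hp.1, hp.2.1⟩
    rw [hg.level_of_isParent hp] at hj
    omega
  have hr : r ∈ T := by
    obtain ⟨t, ht⟩ := hne
    induction t using (measure g).wf.induction with
    | _ t ih =>
    by_cases htr : t = r
    · exact htr ▸ ht
    obtain ⟨p, hp, hpt, hadj⟩ := hpar t (hT ht) htr
    exact ih p hpt (hcl t ht p hp hadj.symm)
  intro t ht
  induction t using (measure g).wf.induction with
  | _ t ih =>
  by_cases htr : t = r
  · exact htr ▸ hr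
  obtain ⟨p, hp, hpt, hadj⟩ := hpar t ht htr
  exact hcl p (ih p hpt hp) t ht hadj

variable [Fintype V]

/-- An edge `x y` within level `j` would close a cycle through the connected set of the levels below
`j`. Neighbours of `x` and `y` in that set lie at level `j - 1`, where induction excludes edges, so
`no_edge_cycle` applies. -/
theorem IsLexBFSRank.level_ne (hg : IsLexBFSRank G g) (hf : IsModuleRank G f) :
    ∀ (j : ℕ) {x y : V}, G.Adj x y → level G g x = j → level G g y ≠ j := by
  intro j
  induction j using Nat.strong_induction_on with
  | _ j ih =>
  intro x y hxy hx hy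
  obtain ⟨r, hr⟩ := hg.exists_inTree x
  have hr' := hg.inTree_of_adj hr hxy
  have hj : 0 < j := by
    by_contra! h
    obtain rfl : j = 0 := by omega
    exact hxy.ne ((hr.eq_of_level_eq_zero hg hx).trans (hr'.eq_of_level_eq_zero hg hy).symm)
  have hex : ∀ {u : V}, InTree G g r u → level G g u = j →
      ∃ t ∈ treeBelow G g r j, G.Adj u t := by
    intro u hu huj
    obtain ⟨p, hp⟩ := exists_isParent_of_level_pos (huj ▸ hj)
    have := hg.level_of_isParent hp
    exact ⟨p, mem_treeBelow.2 ⟨hg.inTree_of_adj hu hp.2.1.symm, by omega⟩, hp.2.1.symm⟩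
  refine hf.no_edge_cycle hxy (treeBelow G g r j) (hg.connectedOn_treeBelow r j)
    (by simp [mem_treeBelow, hx]) (by simp [mem_treeBelow, hy]) (hex hr hx) (hex hr' hy) ?_
  intro t ht u hu hxt hyu htu
  have h₁ := (mem_treeBelow.1 ht).2
  have h₂ := (mem_treeBelow.1 hu).2
  have h₃ := hg.level_adj_le hxt.symm
  have h₄ := hg.level_adj_le hyu.symm
  exact ih (j - 1) (by omega) htu (by omega) (by omega)

/-- Two vertices with a common neighbour at the next level have the same neighbours at the
preceding level. -/
theorem IsLexBFSRank.adj_of_common (hg : IsLexBFSRank G g) (hf : IsModuleRank G f) :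
    ∀ (j : ℕ) {x y v z : V}, level G g x = j + 1 → level G g y = j + 1 → level G g v = j + 2 →
      level G g z = j → G.Adj v x → G.Adj v y → G.Adj x z → G.Adj y z := by
  intro j
  induction j with
  | zero =>
    intro x y v z hx hy hv hz hvx hvy hxz
    obtain ⟨r, hr⟩ := hg.exists_inTree v
    have hry := hg.inTree_of_adj hr hvy
    have hrz := hg.inTree_of_adj (hg.inTree_of_adj hr hvx) hxz
    obtain ⟨p, hp⟩ := exists_isParent_of_level_pos (G := G) (g := g) (u := y) (by omega)
    have hp' := hg.level_of_isParent hp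
    have hrp := hg.inTree_of_adj hry hp.2.1.symm
    rw [hrz.eq_of_level_eq_zero hg hz, ← hrp.eq_of_level_eq_zero hg (by omega)]
    exact hp.2.1.symm
  | succ j ih =>
    intro x y v z hx hy hv hz hvx hvy hxz
    by_contra hyz
    have sy : ∀ {p q : V}, ¬ G.Adj p q → ¬ G.Adj q p := fun h h' => h h'.symm
    have flat : ∀ {a b : V}, level G g a = level G g b → ¬ G.Adj a b := fun h h' =>
      hg.level_ne hf _ h' rfl h.symm
    have far : ∀ {a b : V}, level G g a + 2 ≤ level G g b → ¬ G.Adj a b := fun h h' => by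
      have := hg.level_adj_le h'
      omega
    -- If `x` and `y` have a common neighbour `p` one level nearer to the root, the induction
    -- hypothesis for `z` and `p`, with common neighbour `x`, completes a domino. Otherwise
    -- `no_path_cycle` applies to the path `x v y` and the levels nearer to the root.
    by_cases H : ∃ p, level G g p = j + 1 ∧ G.Adj y p ∧ G.Adj x p
    · obtain ⟨p, hp, hyp, hxp⟩ := H
      obtain ⟨q, hq⟩ := exists_isParent_of_level_pos (G := G) (g := g) (u := z) (by omega)
      have hq' := hg.level_of_isParent hq
      have hpq : G.Adj p q := ih hz hp hx (by omega) hxz hxp hq.2.1.symm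
      exact hf.domino_free (w := p) (a := q) (z := z) (x := x) (v := v) (b := y)
        hpq hq.2.1 hxz.symm hvx.symm hvy hyp hxp.symm (far (by omega)) hyz
        (far (by omega)) (far (by omega))
    · push Not at H
      obtain ⟨r, hr⟩ := hg.exists_inTree v
      have hrx := hg.inTree_of_adj hr hvx
      have hry := hg.inTree_of_adj hr hvy
      obtain ⟨p, hp⟩ := exists_isParent_of_level_pos (G := G) (g := g) (u := y) (by omega)
      have hp' := hg.level_of_isParent hp
      refine hf.no_path_cycle hvx hvy (treeBelow G g r (j + 2)) (hg.connectedOn_treeBelow r _)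
        (by simp [mem_treeBelow, hv]) (by simp [mem_treeBelow, hx]) (by simp [mem_treeBelow, hy])
        (fun t ht => sy (far ?_))
        ⟨z, mem_treeBelow.2 ⟨hg.inTree_of_adj hrx hxz, by omega⟩, hxz⟩
        ⟨p, mem_treeBelow.2 ⟨hg.inTree_of_adj hry hp.2.1.symm, by omega⟩, hp.2.1.symm⟩ ?_
      · have := (mem_treeBelow.1 ht).2
        omega
      · intro t ht hxt hyt
        have h₁ := (mem_treeBelow.1 ht).2
        have h₂ := hg.level_adj_le hxt.symm
        exact H t (by omega) hyt hxt

theorem IsLexBFSRank.isModuleRank (hg : IsLexBFSRank G g) (hf : IsModuleRank G f) :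
    IsModuleRank G g := by
  refine ⟨hg.1, fun v x y hx hy hvx hvy => ⟨fun h => hf.triangle_free hvx h hvy, ?_⟩⟩
  intro z hzv hvz hxz
  by_contra hyz
  have flat : ∀ {a b : V}, level G g a = level G g b → ¬ G.Adj a b := fun h h' =>
    hg.level_ne hf _ h' rfl h.symm
  have far : ∀ {a b : V}, level G g a + 2 ≤ level G g b → ¬ G.Adj a b := fun h h' => by
    have := hg.level_adj_le h'
    omega
  have down : ∀ {a b : V}, G.Adj a b → g b < g a → level G g a = level G g b + 1 :=
    fun {a b} hab hlt => by
      have h₁ := hg.level_adj hab.symm hlt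
      have h₂ : level G g a ≠ level G g b := fun h => flat h hab
      omega
  have hxl := down hvx hx
  have hyl := down hvy hy
  have hne : x ≠ y := by rintro rfl; exact hyz hxz
  obtain ⟨r, hr⟩ := hg.exists_inTree v
  have hrx := hg.inTree_of_adj hr hvx
  have hry := hg.inTree_of_adj hr hvy
  have hpos : 0 < level G g x := by
    by_contra! h
    exact hne ((hrx.eq_of_level_eq_zero hg (by omega)).trans
      (hry.eq_of_level_eq_zero hg (by omega)).symm)
  rcases lt_trichotomy (g z) (g x) with hzx | hzx | hxz'
  · have hzl := down hxz hzx
    exact hyz (hg.adj_of_common hf (level G g z) (by omega) (by omega) (by omega) rfl hvx hvy hxz)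
  · exact hxz.ne (hg.1 hzx).symm
  · have hzl := down hxz.symm hxz'
    have hrz := hg.inTree_of_adj hrx hxz
    have hyz' : g y < g z := by
      by_contra! h
      have := hg.level_mono h ((hg.sameTree_of_adj hvx.symm hx).mono hxz'.le hy.le)
      omega
    -- Here `z` lies at the level of `v`. The four-point property for `y`, `z`, `v` provides `y'`,
    -- at the level of `x` and `y`. The parent `w` of `x` is then adjacent to `y` (through `v`) and
    -- to `y'` (through `z`), which completes a domino.
    obtain ⟨y', hy', hyz'', hyv⟩ := hg.2 y z v hyz' hzv hvy.symm hyz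
    have hyl' := down hyz''.symm (hy'.trans hyz')
    obtain ⟨w, hw⟩ := exists_isParent_of_level_pos hpos
    have hwl := hg.level_of_isParent hw
    have h₁ : G.Adj y w := hg.adj_of_common hf (level G g w) (by omega) (by omega) (by omega)
      rfl hvx hvy hw.2.1.symm
    have h₂ : G.Adj y' w := hg.adj_of_common hf (level G g w) (v := z) (by omega) (by omega)
      (by omega) rfl hxz.symm hyz''.symm hw.2.1.symm
    exact hf.domino_free (w := w) (a := y') (z := z) (x := x) (v := v) (b := y)
      h₂.symm hyz'' hxz.symm hvx.symm hvy h₁ hw.2.1 hyv hyz (flat (by omega)) (flat (by omega))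

end LexBFS

/-! ### Independent module-sequences as ranks. -/

section Orderings

variable {V : Type*} [Fintype V] {G : SimpleGraph V}

theorem isIndependentModuleSequence_iff (φ : Ordering V) :
    IsIndependentModuleSequence G φ ↔ IsModuleRank G fun v => (φ v : ℕ) := by
  have hinj : Function.Injective fun v => (φ v : ℕ) := fun a b h => φ.injective (Fin.ext h)
  constructor
  · refine fun h => ⟨hinj, fun s a b ha hb hsa hsb => ?_⟩
    have ha' : a ∈ before φ (φ s) := ha
    have hb' : b ∈ before φ (φ s) := hb
    obtain ⟨hm, hi⟩ := h (φ s) (by dsimp only at ha; omega)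
    have hma : (⟨a, ha'⟩ : before φ (φ s)) ∈ earlierNbhd G φ (φ s) := by
      simpa [earlierNbhd] using hsa
    have hmb : (⟨b, hb'⟩ : before φ (φ s)) ∈ earlierNbhd G φ (φ s) := by
      simpa [earlierNbhd] using hsb
    constructor
    · intro hab
      exact hi hma hmb (by simpa using hab.ne) (by simpa using hab)
    · intro c hc hsc hac
      have hc' : c ∈ before φ (φ s) := hc
      have := hm _ hma _ hmb
      have h1 : (⟨c, hc'⟩ : before φ (φ s)) ∈
          (G.induce (before φ (φ s))).neighborSet ⟨a, ha'⟩ \ earlierNbhd G φ (φ s) :=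
        ⟨by simpa using hac, by simpa [earlierNbhd] using hsc⟩
      rw [this] at h1
      simpa using h1.1
  · intro h i _
    have hs : ∀ w : before φ i, (φ w : ℕ) < φ (φ.symm i) := fun w => by
      have : φ w < i := w.2
      simpa using this
    constructor
    · have key : ∀ a ∈ earlierNbhd G φ i, ∀ b ∈ earlierNbhd G φ i,
          (G.induce (before φ i)).neighborSet a \ earlierNbhd G φ i ⊆
          (G.induce (before φ i)).neighborSet b \ earlierNbhd G φ i := by
        rintro a ha b hb c ⟨hac, hc⟩
        exact ⟨(h.2 (φ.symm i) a b (hs a) (hs b) ha hb).2 c (hs c) hc (by simpa using hac), hc⟩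
      exact fun a ha b hb => (key a ha b hb).antisymm (key b hb a ha)
    · intro a ha b hb _ hab
      exact (h.2 (φ.symm i) a b (hs a) (hs b) ha hb).1 (by simpa using hab)

end Orderings

/-! ### Labels as binary numbers. -/

section LexValue

variable {α : Type*} {adj : ℕ → α → Prop}

open Classical in
/-- The label of `u` after `k` rounds as a binary number whose digits say which of the visited
vertices are neighbours of `u`. -/
noncomputable def lexValue (adj : ℕ → α → Prop) : ℕ → α → ℕ
  | 0, _ => 0
  | k + 1, u => 2 * lexValue adj k u + if adj k u then 1 else 0

theorem lexValue_succ_of_adj {k : ℕ} {u : α} (h : adj k u) :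
    lexValue adj (k + 1) u = 2 * lexValue adj k u + 1 := by
  simp [lexValue, h]

theorem lexValue_succ_of_not_adj {k : ℕ} {u : α} (h : ¬ adj k u) :
    lexValue adj (k + 1) u = 2 * lexValue adj k u := by
  simp [lexValue, h]

theorem lexValue_succ_bounds (k : ℕ) (u : α) :
    2 * lexValue adj k u ≤ lexValue adj (k + 1) u ∧
      lexValue adj (k + 1) u ≤ 2 * lexValue adj k u + 1 := by
  by_cases h : adj k u
  · rw [lexValue_succ_of_adj h]; omega
  · rw [lexValue_succ_of_not_adj h]; omega

/-- The value after `i` rounds is the leading part of the value after `j` rounds, and dropping final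
digits is monotone. -/
theorem lexValue_le_of_le {i j : ℕ} (hij : i ≤ j) {u v : α}
    (h : lexValue adj j u ≤ lexValue adj j v) : lexValue adj i u ≤ lexValue adj i v := by
  induction j, hij using Nat.le_induction with
  | base => exact h
  | succ j _ ih =>
    have h₁ := lexValue_succ_bounds (adj := adj) j u
    have h₂ := lexValue_succ_bounds (adj := adj) j v
    exact ih (by omega)

theorem exists_of_lexValue_lt {k : ℕ} {u v : α} (h : lexValue adj k u < lexValue adj k v) :
    ∃ j < k, adj j v ∧ ¬ adj j u := by
  induction k with
  | zero => exact absurd h (lt_irrefl _)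
  | succ k ih =>
    by_cases hk : adj k v ∧ ¬ adj k u
    · exact ⟨k, Nat.lt_succ_self k, hk⟩
    · obtain ⟨j, hj, hj'⟩ := ih (by
        by_cases h₁ : adj k v <;> by_cases h₂ : adj k u <;>
          simp_all [lexValue_succ_of_adj, lexValue_succ_of_not_adj]; omega)
      exact ⟨j, hj.trans (Nat.lt_succ_self k), hj'⟩

theorem lexValue_congr {β : Type*} {adj' : ℕ → β → Prop} {k : ℕ} {u : α} {v : β}
    (h : ∀ j < k, adj j u ↔ adj' j v) : lexValue adj k u = lexValue adj' k v := by
  induction k with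
  | zero => rfl
  | succ k ih =>
    have hk := h k (Nat.lt_succ_self k)
    rw [lexValue, lexValue, ih fun j hj => h j (hj.trans (Nat.lt_succ_self k))]
    by_cases h' : adj k u
    · rw [if_pos h', if_pos (hk.1 h')]
    · rw [if_neg h', if_neg (mt hk.2 h')]

open Classical in
/-- The label of `u` after `k` of `n` rounds as a list of numbers. -/
noncomputable def lexList (n : ℕ) (adj : ℕ → α → Prop) : ℕ → α → List ℕ
  | 0, _ => []
  | k + 1, u => lexList n adj k u ++ if adj k u then [n - k] else []

theorem lt_of_mem_lexList {n k : ℕ} (hk : k < n) {u : α} {x : ℕ}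
    (hx : x ∈ lexList n adj k u) : n - k < x := by
  induction k with
  | zero => simp [lexList] at hx
  | succ k ih =>
    rw [lexList, List.mem_append] at hx
    rcases hx with hx | hx
    · have := ih (by omega) hx
      omega
    · split at hx
      · rw [List.mem_singleton] at hx
        omega
      · simp at hx

/-- The condition on `a` is needed when `A` is a proper prefix of `B`: then the first entry of `a`
competes with an entry of `B`. -/
theorem append_lt_append_of_lt {A B a b : List ℕ} (h : A < B)
    (hB : ∀ x ∈ B, ∀ y ∈ a, y < x) : A ++ a < B ++ b := by
  induction A generalizing B with
  | nil =>
    cases B with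
    | nil => exact absurd h (List.lt_irrefl _)
    | cons x B =>
      cases a with
      | nil => exact List.nil_lt_cons _ _
      | cons y a =>
        exact List.cons_lt_cons_iff.2 (Or.inl (hB x (by simp) y (by simp)))
  | cons z A ih =>
    cases B with
    | nil => exact absurd h (List.not_lt_nil _)
    | cons x B =>
      rcases List.cons_lt_cons_iff.1 h with h | ⟨rfl, h'⟩
      · exact List.cons_lt_cons_iff.2 (Or.inl h)
      · exact List.cons_lt_cons_iff.2 (Or.inr ⟨rfl, ih h' fun x hx => hB x (by simp [hx])⟩)

theorem append_singleton_lt (A : List ℕ) (y : ℕ) : A < A ++ [y] := by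
  induction A with
  | nil => exact List.nil_lt_cons _ _
  | cons z A ih => exact List.cons_lt_cons_iff.2 (Or.inr ⟨rfl, ih⟩)

/-- The numbers appended decrease from round to round, so the first round in which two labels differ
decides their comparison, just as the leading differing digit does. -/
theorem lexList_of_lexValue {n k : ℕ} (hk : k ≤ n) {u v : α} :
    (lexValue adj k u < lexValue adj k v → lexList n adj k u < lexList n adj k v) ∧
      (lexValue adj k u = lexValue adj k v → lexList n adj k u = lexList n adj k v) := by
  induction k with
  | zero => exact ⟨fun h => absurd h (lt_irrefl _), fun _ => rfl⟩
  | succ k ih =>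
    obtain ⟨ih₁, ih₂⟩ := ih (by omega)
    have key : ∀ a b : List ℕ, (∀ y ∈ a, y ≤ n - k) →
        lexValue adj k u < lexValue adj k v → lexList n adj k u ++ a < lexList n adj k v ++ b :=
      fun a b ha h => append_lt_append_of_lt (ih₁ h)
        fun x hx y hy => (ha y hy).trans_lt (lt_of_mem_lexList (by omega) hx)
    by_cases h₁ : adj k u <;> by_cases h₂ : adj k v <;>
      simp only [lexList, lexValue, h₁, h₂, if_true, if_false]
    · exact ⟨fun h => key _ _ (by simp) (by omega), fun h => by rw [ih₂ (by omega)]⟩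
    · exact ⟨fun h => key _ _ (by simp) (by omega), fun h => by omega⟩
    · refine ⟨fun h => ?_, fun h => by omega⟩
      rcases lt_or_eq_of_le (show lexValue adj k u ≤ lexValue adj k v by omega) with h | h
      · exact key _ _ (by simp) h
      · rw [ih₂ h, List.append_nil]
        exact append_singleton_lt _ _
    · exact ⟨fun h => key _ _ (by simp) (by omega), fun h => by rw [ih₂ (by omega)]⟩

theorem lexList_le_iff {n k : ℕ} (hk : k ≤ n) {u v : α} :
    lexList n adj k u ≤ lexList n adj k v ↔ lexValue adj k u ≤ lexValue adj k v := by
  constructor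
  · intro h
    by_contra! hlt
    exact not_lt_of_ge h ((lexList_of_lexValue hk).1 hlt)
  · intro h
    rcases lt_or_eq_of_le h with h | h
    · exact le_of_lt ((lexList_of_lexValue hk).1 h)
    · rw [(lexList_of_lexValue hk).2 h]

open Classical in
theorem lexList_eq_map_filter (n k : ℕ) (u : α) :
    lexList n adj k u = ((List.range k).filter (fun j => adj j u)).map (n - ·) := by
  induction k with
  | zero => rfl
  | succ k ih =>
    rw [lexList, ih, List.range_succ, List.filter_append, List.map_append]
    by_cases h : adj k u <;> simp [h]

end LexValue

/-! ### The four-point property of Lex-BFS orderings. -/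

section Orderings

variable {V : Type*} [Fintype V] {G : SimpleGraph V}

/-- The vertex at position `j` is adjacent to `u`. -/
def adjAt (G : SimpleGraph V) (φ : Ordering V) (j : ℕ) (u : V) : Prop :=
  ∃ h : j < Fintype.card V, G.Adj (φ.symm ⟨j, h⟩) u

theorem adjAt_apply {φ : Ordering V} {v u : V} : adjAt G φ (φ v) u ↔ G.Adj v u := by
  simp [adjAt]

theorem lexLabel_eq (φ : Ordering V) (i : Fin (Fintype.card V)) (w : V) :
    lexLabel G φ i w = lexList (Fintype.card V) (adjAt G φ) i w := by
  classical
  have h₁ : lexLabel G φ i w = (((List.finRange (Fintype.card V)).map Fin.val).filter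
      (fun j => j < (i : ℕ) ∧ adjAt G φ j w)).map (fun j => Fintype.card V - j) := by
    -- The coercion of a list of positions to `List ℕ` inside `lexLabel` is a monadic bind.
    have h₀ : ∀ l : List (Fin (Fintype.card V)),
        (do let a ← l; pure (a : ℕ) : List ℕ) = l.map Fin.val := fun l => by
      simp [List.map_eq_flatMap]
    rw [lexLabel, List.filter_map, h₀]
    refine congrArg _ (congrArg _ (List.filter_congr fun j _ => ?_))
    simp [adjAt]
  have h₂ : List.range (Fintype.card V) =
      List.range i ++ (List.range (Fintype.card V - i)).map ((i : ℕ) + ·) := by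
    rw [← List.range_add]
    congr 1
    omega
  rw [h₁, List.map_coe_finRange_eq_range, h₂, List.filter_append, List.map_append,
    lexList_eq_map_filter]
  have h₃ : ((List.range (Fintype.card V - i)).map ((i : ℕ) + ·)).filter
      (fun j => j < (i : ℕ) ∧ adjAt G φ j w) = [] := by
    rw [List.filter_eq_nil_iff]
    simp
  rw [h₃, List.map_nil, List.append_nil]
  congr 1
  refine List.filter_congr fun j hj => ?_
  simp [List.mem_range.1 hj]

theorem isLexBFSOrdering_iff (φ : Ordering V) :
    IsLexBFSOrdering G φ ↔ ∀ v w, φ v ≤ φ w →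
      lexValue (adjAt G φ) (φ v) w ≤ lexValue (adjAt G φ) (φ v) v := by
  refine forall₃_congr fun v w _ => ?_
  rw [lexLabel_eq, lexLabel_eq, lexList_le_iff (φ v).2.le]

/-- When `b` is visited its label is at least that of `c`, hence this holds already after the round
of `a`. That round favoured `c`, so `b` was strictly ahead before it, and some earlier vertex is
adjacent to `b` but not to `c`. -/
theorem IsLexBFSOrdering.isLexBFSRank {φ : Ordering V} (h : IsLexBFSOrdering G φ) :
    IsLexBFSRank G fun v => (φ v : ℕ) := by
  rw [isLexBFSOrdering_iff] at h
  refine ⟨fun a b h => φ.injective (Fin.ext h), fun a b c hab hbc hac hnab => ?_⟩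
  have h₁ := lexValue_le_of_le (i := (φ a : ℕ) + 1) hab (h b c (Fin.le_def.2 hbc.le))
  rw [lexValue_succ_of_adj (adjAt_apply.2 hac),
    lexValue_succ_of_not_adj (mt adjAt_apply.1 hnab)] at h₁
  obtain ⟨j, hj, ⟨hn, hjb⟩, hjc⟩ := exists_of_lexValue_lt
    (show lexValue (adjAt G φ) (φ a) c < lexValue (adjAt G φ) (φ a) b by omega)
  exact ⟨φ.symm ⟨j, hn⟩, by simpa using hj, hjb, fun h => hjc ⟨hn, h⟩⟩

theorem IsIndependentModuleComposed.isIndependentModuleSequence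
    (hG : IsIndependentModuleComposed G) {φ : Ordering V} (h : IsLexBFSOrdering G φ) :
    IsIndependentModuleSequence G φ := by
  obtain ⟨ψ, hψ⟩ := hG
  exact (isIndependentModuleSequence_iff φ).2
    (h.isLexBFSRank.isModuleRank ((isIndependentModuleSequence_iff ψ).1 hψ))

end Orderings

/-! ### Partition refinement and its invariants. -/

/-- The data of partition refinement: the current order of the vertices and its inverse, the
class of each vertex, the first position of each class, the class split off from each class most
recently, and the number of classes. -/
structure Refinement where
  ord : ℕ → ℕ
  pos : ℕ → ℕ
  cls : ℕ → ℕ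
  start : ℕ → ℕ
  split : ℕ → ℕ
  num : ℕ

namespace Refinement

open Function

/-- Whether the class of `w` has not been split yet in the round that began with `b` classes. -/
abbrev Fresh (S : Refinement) (b w : ℕ) : Prop := S.split (S.cls w) < b

/-- The class into which `w` moves. -/
def target (S : Refinement) (b w : ℕ) : ℕ :=
  if S.Fresh b w then S.num else S.split (S.cls w)

/-- Move `w` to the class split off from its class. -/
def move (S : Refinement) (b w : ℕ) : Refinement where
  ord := update (update S.ord (S.start (S.cls w)) w) (S.pos w) (S.ord (S.start (S.cls w)))
  pos := update (update S.pos w (S.start (S.cls w))) (S.ord (S.start (S.cls w))) (S.pos w)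
  cls := update S.cls w (S.target b w)
  start := update (if S.Fresh b w then update S.start S.num (S.start (S.cls w)) else S.start)
    (S.cls w) (S.start (S.cls w) + 1)
  split := if S.Fresh b w then update S.split (S.cls w) S.num else S.split
  num := if S.Fresh b w then S.num + 1 else S.num

/-- The vertices `0, …, n - 1` occupy the positions `0, …, n - 1`. -/
structure IsOrder (S : Refinement) (n : ℕ) : Prop where
  pos_lt : ∀ u < n, S.pos u < n
  ord_pos : ∀ u < n, S.ord (S.pos u) = u
  ord_lt : ∀ i < n, S.ord i < n
  pos_ord : ∀ i < n, S.pos (S.ord i) = i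

/-- From position `k` on, the vertices are in decreasing order of their values, and the classes
are the sets of the vertices with equal values. -/
structure IsRefined (S : Refinement) (n k : ℕ) (val : ℕ → ℕ) : Prop where
  sorted : ∀ u < n, ∀ v < n, k ≤ S.pos u → S.pos u ≤ S.pos v → val v ≤ val u
  cls_iff : ∀ u < n, ∀ v < n, k ≤ S.pos u → k ≤ S.pos v → (S.cls u = S.cls v ↔ val u = val v)
  start_ge : ∀ u < n, k ≤ S.pos u → k ≤ S.start (S.cls u)
  start_le : ∀ u < n, k ≤ S.pos u → S.start (S.cls u) ≤ S.pos u
  cls_start : ∀ u < n, k ≤ S.pos u → S.cls (S.ord (S.start (S.cls u))) = S.cls u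

/-- The values when the vertices in `P` have been moved. -/
def movedValue (val : ℕ → ℕ) (P : Finset ℕ) (u : ℕ) : ℕ := 2 * val u + if u ∈ P then 1 else 0

theorem movedValue_of_mem {val : ℕ → ℕ} {P : Finset ℕ} {u : ℕ} (h : u ∈ P) :
    movedValue val P u = 2 * val u + 1 := by simp [movedValue, h]

theorem movedValue_of_notMem {val : ℕ → ℕ} {P : Finset ℕ} {u : ℕ} (h : u ∉ P) :
    movedValue val P u = 2 * val u := by simp [movedValue, h]

theorem movedValue_insert_of_ne {val : ℕ → ℕ} {P : Finset ℕ} {u w : ℕ} (h : u ≠ w) :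
    movedValue val (insert w P) u = movedValue val P u := by simp [movedValue, h]

/-- The invariant within a round that began with `b` classes. -/
structure InRound (S : Refinement) (n k b : ℕ) (val : ℕ → ℕ) (P : Finset ℕ) : Prop
    extends S.IsOrder n, S.IsRefined n k (movedValue val P) where
  le_num : b ≤ S.num
  split_lt : ∀ c, S.split c < S.num
  cls_lt : ∀ u < n, k ≤ S.pos u → u ∉ P → S.cls u < b
  le_cls : ∀ u < n, k ≤ S.pos u → u ∈ P → b ≤ S.cls u
  cls_lt_num : ∀ u < n, k ≤ S.pos u → u ∈ P → S.cls u < S.num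
  split_iff : ∀ u < n, ∀ v < n, k ≤ S.pos u → k ≤ S.pos v → u ∉ P → v ∈ P →
    (S.split (S.cls u) = S.cls v ↔ val u = val v)
  exists_split : ∀ u < n, k ≤ S.pos u → u ∉ P → ¬ S.Fresh b u →
    ∃ v < n, k ≤ S.pos v ∧ v ∈ P ∧ S.cls v = S.split (S.cls u)

/-- The invariant speaks only of positions from `k` on, so skipping a visited neighbour preserves
it. -/
theorem InRound.congr_visited {S : Refinement} {n k b : ℕ} {val : ℕ → ℕ} {P : Finset ℕ}
    (h : S.InRound n k b val P) {w : ℕ} (hw : S.pos w < k) :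
    S.InRound n k b val (insert w P) := by
  have hne : ∀ u, k ≤ S.pos u → u ≠ w := by rintro u hu rfl; omega
  have hv : ∀ u, k ≤ S.pos u → movedValue val (insert w P) u = movedValue val P u :=
    fun u hu => movedValue_insert_of_ne (hne u hu)
  have hm : ∀ u, k ≤ S.pos u → (u ∈ insert w P ↔ u ∈ P) := fun u hu => by simp [hne u hu]
  refine { h with
    sorted := ?_
    cls_iff := ?_
    cls_lt := ?_
    le_cls := ?_
    cls_lt_num := ?_
    split_iff := ?_
    exists_split := ?_ }
  · intro u hu v hv' h₁ h₂
    rw [hv u h₁, hv v (h₁.trans h₂)]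
    exact h.sorted u hu v hv' h₁ h₂
  · intro u hu v hv' h₁ h₂
    rw [hv u h₁, hv v h₂]
    exact h.cls_iff u hu v hv' h₁ h₂
  · intro u hu h₁ h₂
    exact h.cls_lt u hu h₁ ((hm u h₁).not.1 h₂)
  · intro u hu h₁ h₂
    exact h.le_cls u hu h₁ ((hm u h₁).1 h₂)
  · intro u hu h₁ h₂
    exact h.cls_lt_num u hu h₁ ((hm u h₁).1 h₂)
  · intro u hu v hv' h₁ h₂ h₃ h₄
    exact h.split_iff u hu v hv' h₁ h₂ ((hm u h₁).not.1 h₃) ((hm v h₂).1 h₄)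
  · intro u hu h₁ h₂ h₃
    obtain ⟨v, hv', h₄, h₅, h₆⟩ := h.exists_split u hu h₁ ((hm u h₁).not.1 h₂) h₃
    exact ⟨v, hv', h₄, (hm v h₄).2 h₅, h₆⟩

section Move

variable {S : Refinement} {n k b w : ℕ} {val : ℕ → ℕ} {P : Finset ℕ}

theorem move_ord_of_ne {i : ℕ} (h₁ : i ≠ S.start (S.cls w)) (h₂ : i ≠ S.pos w) :
    (S.move b w).ord i = S.ord i := by simp [move, h₁, h₂]

theorem IsOrder.move (h : S.IsOrder n) (hw : w < n) (hq : S.start (S.cls w) < n) :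
    (S.move b w).IsOrder n := by
  obtain ⟨h₁, h₂, h₃, h₄⟩ := h
  have h₅ := h₁ w hw
  have h₆ := h₂ w hw
  have h₇ := h₃ _ hq
  have h₈ := h₄ _ hq
  constructor
  · intro u hu
    simp only [Refinement.move, update_apply]
    grind
  · intro u hu
    simp only [Refinement.move, update_apply]
    grind
  · intro u hu
    simp only [Refinement.move, update_apply]
    grind
  · intro u hu
    simp only [Refinement.move, update_apply]
    grind

/-- The first vertex of the class of `w`. -/
theorem InRound.first (h : S.InRound n k b val P) (hw : w < n) (hk : k ≤ S.pos w) (hwP : w ∉ P) :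
    ∃ x < n, S.ord (S.start (S.cls w)) = x ∧ S.pos x = S.start (S.cls w) ∧
      k ≤ S.pos x ∧ S.pos x ≤ S.pos w ∧ S.cls x = S.cls w ∧ x ∉ P ∧ val x = val w := by
  have h₁ := h.start_le w hw hk
  have h₂ := h.start_ge w hw hk
  have h₃ := h.cls_start w hw hk
  have h₄ : S.start (S.cls w) < n := h₁.trans_lt (h.pos_lt w hw)
  have h₅ := h.ord_lt _ h₄
  have h₆ := h.pos_ord _ h₄
  generalize S.ord (S.start (S.cls w)) = x at h₃ h₅ h₆
  have h₇ := (h.cls_iff x h₅ w hw (by omega) hk).1 h₃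
  rw [movedValue_of_notMem hwP] at h₇
  have hx : x ∉ P := fun hx => by rw [movedValue_of_mem hx] at h₇; omega
  rw [movedValue_of_notMem hx] at h₇
  exact ⟨x, h₅, rfl, h₆, by omega, by omega, h₃, hx, by omega⟩

/-- With `x` the first vertex of the class of `w`, the move swaps `x` and `w`. Everything ahead of
`x` has a value above `2 * val w`, so the new value `2 * val w + 1` fits at the place of `x`. -/
theorem InRound.move (h : S.InRound n k b val P) (hw : w < n) (hk : k ≤ S.pos w) (hwP : w ∉ P) :
    (S.move b w).InRound n k b val (insert w P) := by
  obtain ⟨x, hx, hox, hpx, hkx, hxw, hcx, hxP, hvx⟩ := h.first hw hk hwP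
  have hpw := h.pos_lt w hw
  have hO := h.toIsOrder.move (b := b) hw (by omega)
  have hpos : ∀ u, (S.move b w).pos u =
      if u = x then S.pos w else if u = w then S.pos x else S.pos u := by
    intro u
    simp only [Refinement.move, update_apply, hox]
    rw [hpx]
  have hpos_ge : ∀ u, k ≤ (S.move b w).pos u → k ≤ S.pos u := by
    intro u hu
    rw [hpos] at hu
    grind
  have hinj : ∀ u < n, ∀ v < n, S.pos u = S.pos v → u = v := fun u hu v hv e => by
    rw [← h.ord_pos u hu, ← h.ord_pos v hv, e]
  have hmx : movedValue val P x = 2 * val w := by rw [movedValue_of_notMem hxP, hvx]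
  have hmw : movedValue val P w = 2 * val w := movedValue_of_notMem hwP
  have hmw' : movedValue val (insert w P) w = 2 * val w + 1 :=
    movedValue_of_mem (Finset.mem_insert_self w P)
  have hm : ∀ u, u ≠ w → movedValue val (insert w P) u = movedValue val P u :=
    fun u => movedValue_insert_of_ne
  have hbefore : ∀ u < n, k ≤ S.pos u → S.pos u < S.pos x → 2 * val w < movedValue val P u := by
    intro u hu hku hlt
    have h₁ := h.sorted u hu x hx hku hlt.le
    have h₂ : S.cls u ≠ S.cls w := fun e => by
      have := h.start_le u hu hku
      rw [e] at this
      omega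
    have h₃ := mt (h.cls_iff u hu w hw hku hk).2 h₂
    omega
  have hcw : (S.move b w).cls w = S.target b w := by simp [Refinement.move]
  have hcne : ∀ u, u ≠ w → (S.move b w).cls u = S.cls u := fun u hu => by
    simp [Refinement.move, hu]
  have hcwb := h.cls_lt w hw hk hwP
  have htb : b ≤ S.target b w := by
    have := h.le_num
    unfold target Fresh
    split <;> omega
  have htn : S.target b w < (S.move b w).num := by
    have := h.split_lt (S.cls w)
    simp only [target, Refinement.move]
    split <;> omega
  have hnum : S.num ≤ (S.move b w).num := by
    simp only [Refinement.move]
    split <;> omega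
  -- In the fresh case the target is a new number, and no moved vertex can share the value of `w`,
  -- since `split_iff` would then give the class of `w` a split number of at least `b`.
  have htarget : ∀ u < n, k ≤ S.pos u → u ∈ P → (S.target b w = S.cls u ↔ val w = val u) := by
    intro u hu hku huP
    have h₁ := h.split_iff w hw u hu hk hku hwP huP
    unfold target
    split
    · rename_i hf
      have h₂ := h.cls_lt_num u hu hku huP
      have h₃ := h.le_cls u hu hku huP
      constructor
      · intro e; omega
      · intro e
        have := h₁.2 e
        unfold Fresh at hf
        omega
    · exact h₁
  have hsplit_w : (S.move b w).split (S.cls w) = S.target b w := by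
    simp only [Refinement.move, target]
    split <;> simp
  have hsplit_ne : ∀ c, c ≠ S.cls w → (S.move b w).split c = S.split c := fun c hc => by
    simp only [Refinement.move]
    split <;> simp [hc]
  have hsorted : ∀ u < n, ∀ v < n, k ≤ (S.move b w).pos u →
      (S.move b w).pos u ≤ (S.move b w).pos v →
      movedValue val (insert w P) v ≤ movedValue val (insert w P) u := by
    intro u hu v hv hku huv
    have hk₁ := hpos_ge u hku
    have hk₂ := hpos_ge v (hku.trans huv)
    have e₁ := hpos u
    have e₂ := hpos v
    by_cases hu1 : u = w
    · subst hu1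
      by_cases hv1 : v = u
      · rw [hv1]
      rw [hmw', hm v hv1]
      have := h.sorted x hx v hv hkx (by grind)
      omega
    by_cases hv1 : v = w
    · subst hv1
      rw [hmw', hm u hu1]
      have hux : u ≠ x := by grind
      have := hbefore u hu hk₁ (by have := hinj u hu x hx; grind)
      omega
    rw [hm u hu1, hm v hv1]
    by_cases hu2 : u = x
    · subst hu2
      by_cases hv2 : v = u
      · rw [hv2]
      have := h.sorted w hw v hv hk (by grind)
      omega
    by_cases hv2 : v = x
    · subst hv2
      have := h.sorted u hu w hw hk₁ (by grind)
      omega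
    exact h.sorted u hu v hv hk₁ (by grind)
  have hpos_w : (S.move b w).pos w = S.pos x := by
    rw [hpos]
    grind
  have hcls_w : ∀ v < n, k ≤ S.pos v → v ≠ w → ((S.move b w).cls w = (S.move b w).cls v ↔
      movedValue val (insert w P) w = movedValue val (insert w P) v) := by
    intro v hv hkv hvw
    rw [hcw, hcne v hvw, hmw', hm v hvw]
    by_cases hvP : v ∈ P
    · rw [htarget v hv hkv hvP, movedValue_of_mem hvP]
      omega
    · have := h.cls_lt v hv hkv hvP
      rw [movedValue_of_notMem hvP]
      omega
  have hstart_w : (S.move b w).start (S.cls w) = S.pos x + 1 := by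
    simp [Refinement.move, hpx]
  have hstart_ne : ∀ c, c ≠ S.cls w → (S.Fresh b w → c ≠ S.num) →
      (S.move b w).start c = S.start c := by
    intro c h₁ h₂
    simp only [Refinement.move]
    rw [update_of_ne h₁]
    split
    · rw [update_of_ne (h₂ ‹_›)]
    · rfl
  have hcn : ∀ u < n, k ≤ S.pos u → S.cls u < S.num := by
    intro u hu hku
    by_cases huP : u ∈ P
    · exact h.cls_lt_num u hu hku huP
    · exact (h.cls_lt u hu hku huP).trans_le h.le_num
  have hord_ne : ∀ i, i ≠ S.pos x → i ≠ S.pos w → (S.move b w).ord i = S.ord i :=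
    fun i h₁ h₂ => move_ord_of_ne (hpx ▸ h₁) h₂
  have hstart : ∀ u < n, k ≤ (S.move b w).pos u →
      k ≤ (S.move b w).start ((S.move b w).cls u) ∧
      (S.move b w).start ((S.move b w).cls u) ≤ (S.move b w).pos u ∧
      (S.move b w).cls ((S.move b w).ord ((S.move b w).start ((S.move b w).cls u))) =
        (S.move b w).cls u := by
    intro u hu hku
    have hku' := hpos_ge u hku
    have e₁ := hpos u
    by_cases huw : u = w
    · subst huw
      have htc : S.target b u ≠ S.cls u := by omega
      by_cases hf : S.Fresh b u
      · have hs : (S.move b u).start (S.target b u) = S.pos x := by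
          simp only [Refinement.move]
          rw [update_of_ne htc, if_pos hf, target, if_pos hf, update_self, hpx]
        rw [hcw, hs, hpos_w]
        refine ⟨hkx, le_rfl, ?_⟩
        rw [← hpos_w, hO.ord_pos u hu, hcw]
      -- The class already split off contains a moved vertex whose value exceeds that of `x`. It
      -- therefore starts ahead of `x`, where the swap changes nothing.
      · have ht : S.target b u = S.split (S.cls u) := if_neg hf
        have hs := hstart_ne (S.target b u) htc (fun h' => absurd h' hf)
        obtain ⟨v, hv, hkv, hvP, hcv⟩ := h.exists_split u hu hku' hwP hf
        have hvv := (htarget v hv hkv hvP).1 (by rw [ht, hcv])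
        have hlt : S.pos v < S.pos x := by
          by_contra! hle
          have := h.sorted x hx v hv hkx hle
          rw [movedValue_of_mem hvP] at this
          omega
        have h₁ := h.start_le v hv hkv
        have h₂ := h.cls_start v hv hkv
        have h₃ := h.start_ge v hv hkv
        rw [hcw, hs, hpos_w, ht, ← hcv]
        refine ⟨h₃, by omega, ?_⟩
        rw [hord_ne _ (by omega) (by omega), hcne, h₂]
        intro e
        have := h.pos_ord (S.start (S.cls v)) (by have := h.pos_lt v hv; omega)
        rw [e] at this
        omega
    rw [hcne u huw]
    by_cases hcu : S.cls u = S.cls w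
    · rw [hcu, hstart_w]
      have h₁ := h.start_le u hu hku'
      rw [hcu, ← hpx] at h₁
      have h₂ : S.pos x + 1 ≤ (S.move b w).pos u := by
        have := hinj u hu x hx
        have := hinj x hx w hw
        grind
      refine ⟨by omega, h₂, ?_⟩
      -- The vertex `y` now right behind the old place of `x` has a value between those of `x` and
      -- `u`, which are equal; so `y` is in the same class.
      have h₃ : S.pos x + 1 < n := by have := hO.pos_lt u hu; omega
      have h₄ := hO.pos_ord _ h₃
      have h₅ := hO.ord_lt _ h₃
      generalize (S.move b w).ord (S.pos x + 1) = y at h₄ h₅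
      have hyw : y ≠ w := by rintro rfl; omega
      have h₆ := hsorted y h₅ u hu (by omega) (by omega)
      rw [hm y hyw, hm u huw] at h₆
      have hky := hpos_ge y (by omega)
      have h₇ := h.sorted x hx y h₅ hkx (by have := hpos y; grind)
      have h₈ := (h.cls_iff u hu w hw hku' hk).1 hcu
      rw [hcne y hyw]
      exact (h.cls_iff y h₅ w hw hky hk).2 (by omega)
    · have hux : u ≠ x := by rintro rfl; exact hcu hcx
      have hs := hstart_ne _ hcu fun _ => (hcn u hu hku').ne
      have h₁ := h.start_le u hu hku'
      have h₂ := h.cls_start u hu hku'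
      have h₃ : S.start (S.cls u) < n := h₁.trans_lt (h.pos_lt u hu)
      have h₄ := h.pos_ord _ h₃
      rw [hs, e₁, if_neg hux, if_neg huw]
      refine ⟨h.start_ge u hu hku', h₁, ?_⟩
      have hyw : S.ord (S.start (S.cls u)) ≠ w := fun e => by
        rw [e] at h₂
        exact hcu h₂.symm
      have hyx : S.ord (S.start (S.cls u)) ≠ x := fun e => by
        rw [e] at h₂
        exact hcu (h₂.symm.trans hcx)
      rw [hord_ne, hcne _ hyw, h₂]
      · intro e
        rw [e, h.ord_pos x hx] at hyx
        exact hyx rfl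
      · intro e
        rw [e, h.ord_pos w hw] at hyw
        exact hyw rfl
  refine { hO with
    sorted := hsorted
    cls_iff := ?_
    start_ge := fun u hu hku => (hstart u hu hku).1
    start_le := fun u hu hku => (hstart u hu hku).2.1
    cls_start := fun u hu hku => (hstart u hu hku).2.2
    le_num := h.le_num.trans hnum
    split_lt := ?_
    cls_lt := ?_
    le_cls := ?_
    cls_lt_num := ?_
    split_iff := ?_
    exists_split := ?_ }
  · intro u hu v hv hku hkv
    have hku' := hpos_ge u hku
    have hkv' := hpos_ge v hkv
    by_cases huw : u = w
    · by_cases hvw : v = w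
      · rw [huw, hvw]
        simp
      · rw [huw]
        exact hcls_w v hv hkv' hvw
    · by_cases hvw : v = w
      · rw [hvw, eq_comm, hcls_w u hu hku' huw, eq_comm]
      · rw [hcne u huw, hcne v hvw, hm u huw, hm v hvw]
        exact h.cls_iff u hu v hv hku' hkv'
  · intro c
    by_cases hc : c = S.cls w
    · rw [hc, hsplit_w]
      exact htn
    · rw [hsplit_ne c hc]
      exact (h.split_lt c).trans_le hnum
  · intro u hu hku huP
    rw [Finset.mem_insert, not_or] at huP
    rw [hcne u huP.1]
    exact h.cls_lt u hu (hpos_ge u hku) huP.2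
  · intro u hu hku huP
    by_cases huw : u = w
    · rw [huw, hcw]
      exact htb
    · rw [hcne u huw]
      exact h.le_cls u hu (hpos_ge u hku) ((Finset.mem_insert.1 huP).resolve_left huw)
  · intro u hu hku huP
    by_cases huw : u = w
    · rw [huw, hcw]
      exact htn
    · rw [hcne u huw]
      exact (hcn u hu (hpos_ge u hku)).trans_le hnum
  · intro u hu v hv hku hkv huP hvP
    have hku' := hpos_ge u hku
    have hkv' := hpos_ge v hkv
    rw [Finset.mem_insert, not_or] at huP
    obtain ⟨huw, huP⟩ := huP
    have huv := h.cls_iff u hu w hw hku' hk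
    rw [hmw, movedValue_of_notMem huP] at huv
    rw [hcne u huw]
    by_cases hvw : v = w
    · rw [hvw, hcw]
      by_cases hc : S.cls u = S.cls w
      · rw [hc, hsplit_w]
        have := huv.1 hc
        omega
      · rw [hsplit_ne _ hc]
        refine ⟨fun e => ?_, fun e => absurd (huv.2 (by omega)) hc⟩
        exfalso
        by_cases hf : S.Fresh b w
        · have := h.split_lt (S.cls u)
          rw [e, target, if_pos hf] at this
          exact lt_irrefl _ this
        · obtain ⟨y, hy, hky, hyP, hcy⟩ := h.exists_split w hw hk hwP hf
          have ht : S.target b w = S.split (S.cls w) := if_neg hf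
          have h₁ := (htarget y hy hky hyP).1 (by rw [ht, hcy])
          have h₂ := (h.split_iff u hu y hy hku' hky huP hyP).1 (by rw [e, ht, hcy])
          exact hc (huv.2 (by omega))
    · have hvP := (Finset.mem_insert.1 hvP).resolve_left hvw
      rw [hcne v hvw]
      by_cases hc : S.cls u = S.cls w
      · rw [hc, hsplit_w, htarget v hv hkv' hvP]
        have := huv.1 hc
        omega
      · rw [hsplit_ne _ hc]
        exact h.split_iff u hu v hv hku' hkv' huP hvP
  · intro u hu hku huP hf
    have hku' := hpos_ge u hku
    rw [Finset.mem_insert, not_or] at huP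
    obtain ⟨huw, huP⟩ := huP
    rw [Fresh, hcne u huw] at hf
    rw [hcne u huw]
    by_cases hc : S.cls u = S.cls w
    · exact ⟨w, hw, by omega, Finset.mem_insert_self w P, by rw [hc, hsplit_w, hcw]⟩
    · rw [hsplit_ne _ hc] at hf ⊢
      obtain ⟨v, hv, hkv, hvP, hcv⟩ := h.exists_split u hu hku' huP hf
      have hvw : v ≠ w := by rintro rfl; exact hwP hvP
      refine ⟨v, hv, ?_, Finset.mem_insert_of_mem hvP, by rw [hcne v hvw, hcv]⟩
      rw [hpos]
      grind

end Move

/-- `u` is in the list of the vertex at position `j`. -/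
def listed (S : Refinement) (nbrs : ℕ → List ℕ) (j u : ℕ) : Prop := u ∈ nbrs (S.ord j)

/-- Lists of numbers below `n` without repetition. -/
def IsNumbered (nbrs : ℕ → List ℕ) (n : ℕ) : Prop :=
  ∀ a < n, (nbrs a).Nodup ∧ ∀ w ∈ nbrs a, w < n

/-- The lists are increasing, and `0, …, n - 1` is a Lex-BFS ordering. -/
def IsPresorted (nbrs : ℕ → List ℕ) (n : ℕ) : Prop :=
  (∀ a < n, (nbrs a).Pairwise (· < ·)) ∧ ∀ i < n, ∀ a < n, i ≤ a →
    lexValue (fun j u => u ∈ nbrs j) i a ≤ lexValue (fun j u => u ∈ nbrs j) i i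

/-- The first `k` positions hold a Lex-BFS ordering as far as it goes. -/
def IsLexBFSUpTo (S : Refinement) (nbrs : ℕ → List ℕ) (n k : ℕ) : Prop :=
  ∀ i < k, ∀ u < n, i ≤ S.pos u →
    lexValue (S.listed nbrs) i u ≤ lexValue (S.listed nbrs) i (S.ord i)

/-- The invariant between the rounds. -/
structure BeforeRound (S : Refinement) (nbrs : ℕ → List ℕ) (n k : ℕ) : Prop
    extends S.IsOrder n, S.IsRefined n k (lexValue (S.listed nbrs) k) where
  split_lt : ∀ c, S.split c < S.num
  cls_lt_num : ∀ u < n, k ≤ S.pos u → S.cls u < S.num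
  lexBFS : S.IsLexBFSUpTo nbrs n k
  ident : IsPresorted nbrs n → ∀ i < n, S.ord i = i

/-- The invariant within round `k` when `i` members of the list have been treated. -/
structure AmidRound (S : Refinement) (nbrs : ℕ → List ℕ) (n k b i : ℕ) : Prop
    extends S.InRound n (k + 1) b (lexValue (S.listed nbrs) k)
      ((nbrs (S.ord k)).take i).toFinset where
  lexBFS : S.IsLexBFSUpTo nbrs n (k + 1)
  ident : IsPresorted nbrs n → ∀ i < n, S.ord i = i

/-- Remove the vertex at position `k` from its class. -/
def visit (S : Refinement) (k : ℕ) : Refinement :=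
  { S with start := update S.start (S.cls (S.ord k)) (k + 1) }

/-- Treat the neighbour `w` of the vertex at position `k`. -/
def scan (S : Refinement) (b k w : ℕ) : Refinement := if k < S.pos w then S.move b w else S

variable {S S' : Refinement} {nbrs : ℕ → List ℕ} {n k b i : ℕ}

theorem BeforeRound.of_initial {s : Refinement} (ho : ∀ i < n, s.ord i = i)
    (hp : ∀ i < n, s.pos i = i) (hc : ∀ i, s.cls i = 0) (hs : ∀ i, s.start i = 0)
    (ht : ∀ i, s.split i = 0) (hn : s.num = 1) : s.BeforeRound nbrs n 0 where
  pos_lt u hu := by rwa [hp u hu]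
  ord_pos u hu := by rw [hp u hu, ho u hu]
  ord_lt u hu := by rwa [ho u hu]
  pos_ord u hu := by rw [ho u hu, hp u hu]
  sorted u _ v _ _ _ := le_rfl
  cls_iff u _ v _ _ _ := by simp [hc, lexValue]
  start_ge u _ _ := Nat.zero_le _
  start_le u _ _ := by rw [hs]; exact Nat.zero_le _
  cls_start u _ _ := by rw [hc, hc]
  split_lt c := by rw [ht, hn]; exact one_pos
  cls_lt_num u _ _ := by rw [hc, hn]; exact one_pos
  lexBFS i hi := absurd hi (Nat.not_lt_zero i)
  ident _ := ho

/-- The vertex at position `k` heads the sorted order, so its label is largest. No class has been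
split in the new round because every split number is below the current number of classes; hence
`split` needs no resetting. -/
theorem BeforeRound.visit (h : S.BeforeRound nbrs n k) (hk : k < n) :
    (S.visit k).AmidRound nbrs n k S.num 0 := by
  have hm : ∀ u, movedValue (lexValue (S.listed nbrs) k) ∅ u =
      2 * lexValue (S.listed nbrs) k u := fun u => movedValue_of_notMem (Finset.notMem_empty u)
  have hv := h.ord_lt k hk
  have hpv := h.pos_ord k hk
  have hstart : ∀ u < n, k + 1 ≤ S.pos u →
      k + 1 ≤ (S.visit k).start (S.cls u) ∧ (S.visit k).start (S.cls u) ≤ S.pos u ∧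
        S.cls (S.ord ((S.visit k).start (S.cls u))) = S.cls u := by
    intro u hu hku
    have hku' : k ≤ S.pos u := by omega
    have hpu := h.pos_lt u hu
    by_cases hc : S.cls u = S.cls (S.ord k)
    · have hs : (S.visit k).start (S.cls u) = k + 1 := by simp [Refinement.visit, hc]
      rw [hs]
      refine ⟨le_rfl, hku, ?_⟩
      have hy := h.ord_lt (k + 1) (by omega)
      have hpy := h.pos_ord (k + 1) (by omega)
      have h₁ := h.sorted _ hv _ hy (by omega) (by omega)
      have h₂ := h.sorted _ hy u hu (by omega) (by omega)
      have h₃ := (h.cls_iff u hu _ hv hku' (by omega)).1 hc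
      exact (h.cls_iff _ hy u hu (by omega) hku').2 (by omega)
    · have hs : (S.visit k).start (S.cls u) = S.start (S.cls u) := by
        simp [Refinement.visit, hc]
      have h₁ := h.start_ge u hu hku'
      have h₂ := h.cls_start u hu hku'
      rw [hs]
      refine ⟨?_, h.start_le u hu hku', h₂⟩
      rcases h₁.lt_or_eq with h₁ | h₁
      · exact h₁
      · rw [← h₁] at h₂
        exact absurd h₂.symm hc
  exact
    { h.toIsOrder with
      sorted := fun u hu v hv hku huv => by
        have := h.sorted u hu v hv (by have : k + 1 ≤ S.pos u := hku; omega) huv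
        change movedValue (lexValue (S.listed nbrs) k) ∅ v ≤
          movedValue (lexValue (S.listed nbrs) k) ∅ u
        rw [hm, hm]
        omega
      cls_iff := fun u hu v hv hku hkv => by
        have := h.cls_iff u hu v hv (by have : k + 1 ≤ S.pos u := hku; omega)
          (by have : k + 1 ≤ S.pos v := hkv; omega)
        change S.cls u = S.cls v ↔ movedValue (lexValue (S.listed nbrs) k) ∅ u =
          movedValue (lexValue (S.listed nbrs) k) ∅ v
        rw [hm, hm, this]
        omega
      start_ge := fun u hu hku => (hstart u hu hku).1
      start_le := fun u hu hku => (hstart u hu hku).2.1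
      cls_start := fun u hu hku => (hstart u hu hku).2.2
      le_num := le_rfl
      split_lt := h.split_lt
      cls_lt := fun u hu hku _ => h.cls_lt_num u hu (by have : k + 1 ≤ S.pos u := hku; omega)
      le_cls := fun u _ _ hu => absurd hu (by simp)
      cls_lt_num := fun u _ _ hu => absurd hu (by simp)
      split_iff := fun u _ v _ _ _ _ hv => absurd hv (by simp)
      exists_split := fun u hu hku _ hf => absurd (h.split_lt _) hf
      lexBFS := fun i hi u hu hiu => by
        rcases Nat.lt_succ_iff_lt_or_eq.1 hi with hi | rfl
        · exact h.lexBFS i hi u hu hiu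
        · exact h.sorted _ hv u hu hpv.ge (hpv.le.trans hiu)
      ident := h.ident }

theorem lexValue_listed_congr (h : ∀ j < k, S'.ord j = S.ord j) {i : ℕ} (hi : i ≤ k) (u : ℕ) :
    lexValue (S'.listed nbrs) i u = lexValue (S.listed nbrs) i u :=
  lexValue_congr fun j hj => by rw [listed, listed, h j (hj.trans_le hi)]

theorem InRound.ord_scan {val : ℕ → ℕ} {P : Finset ℕ} (h : S.InRound n (k + 1) b val P) {w : ℕ}
    (hw : w < n) {j : ℕ} (hj : j ≤ k) : (S.scan b k w).ord j = S.ord j := by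
  unfold scan
  split
  · have := h.start_ge w hw (by omega)
    exact move_ord_of_ne (by omega) (by omega)
  · rfl

/-- A swap involves only positions after `k`, so no vertex crosses a boundary `j ≤ k + 1`. -/
theorem InRound.pos_scan {val : ℕ → ℕ} {P : Finset ℕ} (h : S.InRound n (k + 1) b val P) {w : ℕ}
    (hw : w < n) (hwP : w ∉ P) {j u : ℕ} (hj : j ≤ k + 1) (hu : j ≤ (S.scan b k w).pos u) :
    j ≤ S.pos u := by
  unfold scan at hu
  split at hu
  · rename_i hkw
    obtain ⟨x, _, hox, hpx, hkx, _⟩ := h.first hw hkw hwP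
    simp only [Refinement.move, update_apply, hox] at hu
    grind
  · exact hu

/-- By `hval` no unmoved vertex with the value of `w` precedes it, so `w` is first in its class and
is swapped with itself. -/
theorem InRound.ord_scan_ident {val : ℕ → ℕ} {P : Finset ℕ} (h : S.InRound n (k + 1) b val P)
    {w : ℕ} (hw : w < n) (hwP : w ∉ P) (hord : ∀ i < n, S.ord i = i)
    (hval : ∀ x < w, k < x → x ∉ P → val x ≠ val w) : ∀ i < n, (S.scan b k w).ord i = i := by
  intro i hi
  unfold scan
  split
  · rename_i hkw
    obtain ⟨x, hx, hox, hpx, hkx, hxw, -, hxP, hxv⟩ := h.first hw hkw hwP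
    have hpos : ∀ u < n, S.pos u = u := fun u hu => by
      rw [← hord (S.pos u) (h.pos_lt u hu), h.ord_pos u hu]
    rw [hpos x hx] at hpx hkx hxw
    rw [hpos w hw] at hxw hkw
    rcases hxw.lt_or_eq with hlt | rfl
    · exact absurd hxv (hval x hlt hkx hxP)
    · have := hord i hi
      simp only [Refinement.move, update_apply, hpos x hx, ← hpx]
      grind
  · exact hord i hi

theorem AmidRound.scan (h : S.AmidRound nbrs n k b i) (hL : IsNumbered nbrs n) (hk : k < n)
    (hi : i < (nbrs (S.ord k)).length) :
    (S.scan b k (nbrs (S.ord k))[i]).AmidRound nbrs n k b (i + 1) := by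
  obtain ⟨hnd, hlt⟩ := hL _ (h.ord_lt k hk)
  have hw := hlt _ (List.getElem_mem hi)
  have hwP : (nbrs (S.ord k))[i] ∉ ((nbrs (S.ord k)).take i).toFinset := by
    rw [List.mem_toFinset, List.mem_take_iff_getElem]
    rintro ⟨j, hj, e⟩
    have := (hnd.getElem_inj_iff).1 e
    omega
  have hP : insert (nbrs (S.ord k))[i] ((nbrs (S.ord k)).take i).toFinset =
      ((nbrs (S.ord k)).take (i + 1)).toFinset := by
    ext u
    rw [List.take_succ_eq_append_getElem hi]
    simp only [Finset.mem_insert, List.mem_toFinset, List.mem_append, List.mem_singleton]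
    exact or_comm
  have hmem : ∀ x ∈ nbrs (S.ord k), (nbrs (S.ord k)).Pairwise (· < ·) →
      x < (nbrs (S.ord k))[i] → x ∈ ((nbrs (S.ord k)).take i).toFinset := by
    intro x hx hs hxw
    obtain ⟨j, hj, rfl⟩ := List.getElem_of_mem hx
    rw [List.mem_toFinset, List.mem_take_iff_getElem]
    refine ⟨j, ?_, rfl⟩
    by_contra! hij
    rcases (show i ≤ j by omega).lt_or_eq with hij | rfl
    · have := List.pairwise_iff_getElem.1 hs i j hi hj hij
      omega
    · omega
  have hwmem := List.getElem_mem hi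
  generalize (nbrs (S.ord k))[i] = w at hw hwP hP hmem hwmem
  have hord : ∀ {j}, j ≤ k → (S.scan b k w).ord j = S.ord j :=
    fun hj => h.toInRound.ord_scan hw hj
  have hval : ∀ {j}, j ≤ k → ∀ u, lexValue ((S.scan b k w).listed nbrs) j u =
      lexValue (S.listed nbrs) j u :=
    fun hj u => lexValue_listed_congr (fun l hl => hord hl.le) hj u
  have hIn : (S.scan b k w).InRound n (k + 1) b (lexValue ((S.scan b k w).listed nbrs) k)
      ((nbrs ((S.scan b k w).ord k)).take (i + 1)).toFinset := by
    rw [hord le_rfl, ← hP, funext (hval le_rfl)]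
    unfold Refinement.scan
    split
    · exact h.toInRound.move hw (by omega) hwP
    · exact h.toInRound.congr_visited (by omega)
  refine { hIn with lexBFS := ?_, ident := ?_ }
  · intro j hj u hu hju
    have hjk : j ≤ k := by omega
    rw [hval hjk, hval hjk, hord hjk]
    exact h.lexBFS j hj u hu (h.toInRound.pos_scan hw hwP (by omega) hju)
  · intro hs
    have hid := h.ident hs
    -- An unmoved `x < w` is not in the increasing list of `k`. If `x` and `w` had equal values,
    -- round `k` would put `w` strictly ahead of `x`, contrary to the numbering being a Lex-BFS
    -- ordering.
    refine h.toInRound.ord_scan_ident hw hwP hid fun x hx hkx hxP e => ?_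
    have hidk := hid k hk
    have hxl : x ∉ nbrs k := fun hx' => hxP (hmem x (hidk.symm ▸ hx') (by
      rw [hidk]
      exact hs.1 k hk) hx)
    rw [hidk] at hwmem
    have hcg : ∀ u, lexValue (S.listed nbrs) k u = lexValue (fun j u => u ∈ nbrs j) k u :=
      fun u => lexValue_congr fun j hj => by rw [listed, hid j (hj.trans hk)]
    have h₁ := lexValue_le_of_le (i := k + 1) hkx (hs.2 x (hx.trans hw) w hw hx.le)
    rw [lexValue_succ_of_adj (adj := fun j u => u ∈ nbrs j) hwmem,
      lexValue_succ_of_not_adj (adj := fun j u => u ∈ nbrs j) hxl, ← hcg, ← hcg, e] at h₁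
    omega

theorem AmidRound.beforeRound (h : S.AmidRound nbrs n k b (nbrs (S.ord k)).length) :
    S.BeforeRound nbrs n (k + 1) := by
  have hv : movedValue (lexValue (S.listed nbrs) k)
      ((nbrs (S.ord k)).take (nbrs (S.ord k)).length).toFinset =
      lexValue (S.listed nbrs) (k + 1) := by
    funext u
    rw [List.take_length]
    by_cases hu : u ∈ nbrs (S.ord k)
    · rw [movedValue_of_mem (List.mem_toFinset.2 hu)]
      exact (lexValue_succ_of_adj (adj := S.listed nbrs) hu).symm
    · rw [movedValue_of_notMem (mt List.mem_toFinset.1 hu)]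
      exact (lexValue_succ_of_not_adj (adj := S.listed nbrs) hu).symm
  have hR := h.toIsRefined
  rw [hv] at hR
  refine { h.toIsOrder, hR with
    split_lt := h.split_lt
    cls_lt_num := fun u hu hku => ?_
    lexBFS := h.lexBFS
    ident := h.ident }
  by_cases huP : u ∈ ((nbrs (S.ord k)).take (nbrs (S.ord k)).length).toFinset
  · exact h.cls_lt_num u hu hku huP
  · exact (h.cls_lt u hu hku huP).trans_le h.le_num

end Refinement

/-! ### Step counts for loop-free programs and loops. -/

section Execution

/-- One program after the other. -/
def block : List Program → Program
  | [] => .skip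
  | [p] => p
  | p :: q :: l => .seq p (block (q :: l))

/-- Programs without loops. -/
def Program.LoopFree : Program → Prop
  | .seq p q => p.LoopFree ∧ q.LoopFree
  | .ite _ p q => p.LoopFree ∧ q.LoopFree
  | .loop _ _ => False
  | _ => True

open Classical in
/-- The result of a program without loops. -/
noncomputable def Program.eval : Program → State → State
  | .skip, s => s
  | .const x k, s => s.setVar x k
  | .copy x y, s => s.setVar x (s.var y)
  | .succ x y, s => s.setVar x (s.var y + 1)
  | .pred x y, s => s.setVar x (s.var y - 1)
  | .load x a y, s => s.setVar x (s.arr a (s.var y))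
  | .store a x y, s => s.setArr a (s.var x) (s.var y)
  | .seq p q, s => q.eval (p.eval s)
  | .ite b p q, s => if b.Holds s then p.eval s else q.eval s
  | .loop _ _, s => s

/-- A bound for the number of steps of a program without loops. -/
def Program.size : Program → ℕ
  | .seq p q => p.size + q.size
  | .ite _ p q => p.size + q.size + 1
  | .loop _ _ => 0
  | _ => 1

theorem Program.LoopFree.exec {p : Program} (hp : p.LoopFree) (s : State) :
    ∃ t ≤ p.size, Exec p s (p.eval s) t := by
  induction p generalizing s with
  | skip => exact ⟨1, le_rfl, .skip s⟩
  | const x k => exact ⟨1, le_rfl, .const s x k⟩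
  | copy x y => exact ⟨1, le_rfl, .copy s x y⟩
  | succ x y => exact ⟨1, le_rfl, .succ s x y⟩
  | pred x y => exact ⟨1, le_rfl, .pred s x y⟩
  | load x a y => exact ⟨1, le_rfl, .load s x a y⟩
  | store a x y => exact ⟨1, le_rfl, .store s a x y⟩
  | seq p q ihp ihq =>
    obtain ⟨t, ht, h⟩ := ihp hp.1 s
    obtain ⟨u, hu, h'⟩ := ihq hp.2 (p.eval s)
    exact ⟨t + u, Nat.add_le_add ht hu, h.seq h'⟩
  | ite b p q ihp ihq =>
    by_cases hb : b.Holds s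
    · obtain ⟨t, ht, h⟩ := ihp hp.1 s
      refine ⟨t + 1, by simp only [Program.size]; omega, ?_⟩
      simpa only [Program.eval, if_pos hb] using Exec.ite_true (q := q) hb h
    · obtain ⟨t, ht, h⟩ := ihq hp.2 s
      refine ⟨t + 1, by simp only [Program.size]; omega, ?_⟩
      simpa only [Program.eval, if_neg hb] using Exec.ite_false (p := p) hb h
  | loop b p => exact hp.elim

/-- A loop with an invariant that counts the iterations and the steps. -/
theorem exec_loop {b : Test} {p : Program} {N : ℕ} {I : ℕ → State → ℕ → Prop}
    (step : ∀ i < N, ∀ s τ, I i s τ → b.Holds s ∧ ∃ s' t, Exec p s s' t ∧ I (i + 1) s' (τ + t + 1))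
    (finish : ∀ s τ, I N s τ → ¬ b.Holds s) {s : State} {τ : ℕ} (h : I 0 s τ) :
    ∃ s' t, Exec (.loop b p) s s' (t + 1) ∧ I N s' (τ + t) := by
  -- Induction on the number `m` of iterations left; the one step outside the count of the invariant
  -- is the final failing test.
  have key : ∀ m ≤ N, ∀ s τ, I (N - m) s τ →
      ∃ s' t, Exec (.loop b p) s s' (t + 1) ∧ I N s' (τ + t) := by
    intro m
    induction m with
    | zero => exact fun _ s τ h => ⟨s, 0, .loop_false (finish s τ h), h⟩
    | succ m ih =>
      intro hm s τ h
      obtain ⟨hb, s₁, t, he, h₁⟩ := step (N - (m + 1)) (by omega) s τ h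
      rw [show N - (m + 1) + 1 = N - m by omega] at h₁
      obtain ⟨s₂, u, he', h₂⟩ := ih (by omega) s₁ _ h₁
      refine ⟨s₂, t + (u + 1), .loop_true hb he he', ?_⟩
      rwa [show τ + (t + (u + 1)) = τ + t + 1 + u by omega]
  exact key N le_rfl s τ (by rwa [Nat.sub_self])

end Execution

/-! ### The Lex-BFS program and its running time. -/

section Programs

/-! Variables: `0` number of vertices, `1` round, `2` visited vertex, `3` and `4` current index
and end of its list, `5` number of classes at the beginning of the round, `6` number of classes.
Arrays: `2` order, `3` positions, `4` classes, `5` first positions of the classes, `6` the classes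
split off. -/

def moveProgram : Program := block [
  .load 9 4 7,
  .load 10 6 9,
  .ite (.lt 10 5)
    (block [.copy 10 6, .succ 6 6, .store 6 9 10, .load 11 5 9, .store 5 10 11])
    .skip,
  .load 11 5 9,
  .load 12 2 11,
  .store 2 11 7,
  .store 2 8 12,
  .store 3 7 11,
  .store 3 12 8,
  .store 4 7 10,
  .succ 11 11,
  .store 5 9 11]

def scanProgram : Program := block [
  .load 7 1 3,
  .load 8 3 7,
  .ite (.lt 1 8) moveProgram .skip,
  .succ 3 3]

def visitProgram : Program := block [
  .load 2 2 1,
  .load 9 4 2,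
  .succ 13 1,
  .store 5 9 13,
  .copy 5 6,
  .load 3 0 2,
  .succ 13 2,
  .load 4 0 13]

def roundProgram : Program :=
  .seq visitProgram (.seq (.loop (.lt 3 4) scanProgram) (.succ 1 1))

def initProgram : Program := block [.store 2 1 1, .store 3 1 1, .succ 1 1]

def lexBFSProgram : Program :=
  .seq (.loop (.lt 1 0) initProgram)
    (.seq (block [.const 1 0, .const 6 1]) (.loop (.lt 1 0) roundProgram))

/-- The data of partition refinement in the memory. -/
def view (s : State) : Refinement where
  ord := s.arr 2
  pos := s.arr 3
  cls := s.arr 4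
  start := s.arr 5
  split := s.arr 6
  num := s.var 6

open Function

theorem eval_moveProgram (s : State) (h : s.var 8 = s.arr 3 (s.var 7)) :
    view (moveProgram.eval s) = (view s).move (s.var 5) (s.var 7) ∧
      (∀ x ∈ [0, 1, 3, 4, 5], (moveProgram.eval s).var x = s.var x) ∧
      ∀ a ∈ [0, 1], (moveProgram.eval s).arr a = s.arr a := by
  by_cases hf : s.arr 6 (s.arr 4 (s.var 7)) < s.var 5
  · simp [moveProgram, block, Program.eval, State.setVar, State.setArr, view, Refinement.move,
      Refinement.target, Refinement.Fresh, Test.Holds, update_apply, hf, h]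
  · simp [moveProgram, block, Program.eval, State.setVar, State.setArr, view, Refinement.move,
      Refinement.target, Refinement.Fresh, Test.Holds, update_apply, hf, h]

theorem eval_scanProgram (s : State) :
    view (scanProgram.eval s) =
      (view s).scan (s.var 5) (s.var 1) (s.arr 1 (s.var 3)) ∧
    (∀ x ∈ [0, 1, 4, 5], (scanProgram.eval s).var x = s.var x) ∧
    (scanProgram.eval s).var 3 = s.var 3 + 1 ∧
    ∀ a ∈ [0, 1], (scanProgram.eval s).arr a = s.arr a := by
  have h := eval_moveProgram
    ((s.setVar 7 (s.arr 1 (s.var 3))).setVar 8 (s.arr 3 (s.arr 1 (s.var 3)))) (by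
      simp [State.setVar])
  simp only [view, State.setVar, List.mem_cons, List.not_mem_nil, or_false, forall_eq_or_imp,
    forall_eq] at h
  by_cases hp : s.var 1 < s.arr 3 (s.arr 1 (s.var 3))
  · simp [scanProgram, block, Program.eval, State.setVar, view, Refinement.scan, Test.Holds, hp]
    simp_all
  · simp [scanProgram, block, Program.eval, State.setVar, view, Refinement.scan, Test.Holds, hp]

theorem eval_visitProgram (s : State) :
    view (visitProgram.eval s) = (view s).visit (s.var 1) ∧
    (∀ x ∈ [0, 1], (visitProgram.eval s).var x = s.var x) ∧
    (visitProgram.eval s).var 3 = s.arr 0 (s.arr 2 (s.var 1)) ∧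
    (visitProgram.eval s).var 4 = s.arr 0 (s.arr 2 (s.var 1) + 1) ∧
    (visitProgram.eval s).var 5 = s.var 6 ∧
    ∀ a ∈ [0, 1], (visitProgram.eval s).arr a = s.arr a := by
  simp [visitProgram, block, Program.eval, State.setVar, State.setArr, view, Refinement.visit]

theorem eval_initProgram (s : State) :
    initProgram.eval s = ((s.setArr 2 (s.var 1) (s.var 1)).setArr 3 (s.var 1) (s.var 1)).setVar 1
      (s.var 1 + 1) := by
  simp [initProgram, block, Program.eval, State.setVar, State.setArr]

/-- The arrays `off` and `lists` hold the lists `nbrs` one after the other. -/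
def Represents (off lists : ℕ → ℕ) (nbrs : ℕ → List ℕ) (n : ℕ) : Prop :=
  ∀ a < n, off (a + 1) = off a + (nbrs a).length ∧
    ∀ (i : ℕ) (h : i < (nbrs a).length), lists (off a + i) = (nbrs a)[i]

variable {off lists : ℕ → ℕ} {nbrs : ℕ → List ℕ} {n : ℕ}

theorem exec_scanLoop (hr : Represents off lists nbrs n) (hL : Refinement.IsNumbered nbrs n)
    {s : State} {k v b : ℕ} (hk : k < n) (h₁ : s.var 1 = k)
    (h₃ : s.var 3 = off v) (h₄ : s.var 4 = off (v + 1)) (h₅ : s.var 5 = b)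
    (hoff : s.arr 0 = off) (hlists : s.arr 1 = lists) (hv : s.arr 2 k = v)
    (h : (view s).AmidRound nbrs n k b 0) :
    ∃ s' t, Exec (.loop (.lt 3 4) scanProgram) s s' t ∧ t ≤ 30 * (nbrs v).length + 1 ∧
      s'.var 0 = s.var 0 ∧ s'.var 1 = k ∧ s'.arr 0 = off ∧ s'.arr 1 = lists ∧
      (view s').AmidRound nbrs n k b (nbrs v).length ∧ ∀ j ≤ k, s'.arr 2 j = s.arr 2 j := by
  have hvn : v < n := hv ▸ h.ord_lt k hk
  obtain ⟨hoff', hlists'⟩ := hr v hvn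
  obtain ⟨s', t, he, h'⟩ := exec_loop (b := .lt 3 4) (p := scanProgram) (N := (nbrs v).length)
    (I := fun i s' τ => τ ≤ 30 * i ∧ s'.var 0 = s.var 0 ∧ s'.var 1 = k ∧ s'.var 3 = off v + i ∧
      s'.var 4 = off (v + 1) ∧ s'.var 5 = b ∧ s'.arr 0 = off ∧ s'.arr 1 = lists ∧
      (view s').AmidRound nbrs n k b i ∧ ∀ j ≤ k, s'.arr 2 j = s.arr 2 j)
    (by
      rintro i hi s' τ ⟨hτ, e₀, e₁, e₃, e₄, e₅, a₀, a₁, hs', hord⟩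
      have hb : (Test.lt 3 4).Holds s' := by
        simp only [Test.Holds]
        omega
      obtain ⟨t, ht, he⟩ := Program.LoopFree.exec (p := scanProgram)
        (by simp [scanProgram, moveProgram, block, Program.LoopFree]) s'
      -- With the loop test an iteration takes at most 24 steps, which the budget of 30 covers.
      have ht' : scanProgram.size = 23 := rfl
      obtain ⟨hview, hvar, hvar3, harr⟩ := eval_scanProgram s'
      have hordk : (view s').ord k = v := (hord k le_rfl).trans hv
      have hw : s'.arr 1 (s'.var 3) = (nbrs v)[i] := by rw [a₁, e₃, hlists' i hi]
      have hscan := hs'.scan hL hk (by rw [hordk]; exact hi)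
      have hlt : (nbrs v)[i] < n := (hL v hvn).2 _ (List.getElem_mem hi)
      simp only [hordk] at hscan
      rw [e₅, e₁, hw] at hview
      refine ⟨hb, _, t, he, by omega, ?_, ?_, ?_, ?_, ?_, ?_, ?_, ?_, ?_⟩
      · rw [hvar 0 (by simp), e₀]
      · rw [hvar 1 (by simp), e₁]
      · rw [hvar3, e₃, Nat.add_assoc]
      · rw [hvar 4 (by simp), e₄]
      · rw [hvar 5 (by simp), e₅]
      · rw [harr 0 (by simp), a₀]
      · rw [harr 1 (by simp), a₁]
      · rw [hview]
        exact hscan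
      · intro j hj
        rw [← hord j hj]
        have : (view (scanProgram.eval s')).ord j = (view s').ord j := by
          rw [hview]
          exact hs'.toInRound.ord_scan hlt hj
        exact this)
    (by
      rintro s' τ ⟨-, -, -, e₃, e₄, -⟩ hb
      simp only [Test.Holds] at hb
      omega)
    (s := s) (τ := 0)
    ⟨le_rfl, rfl, h₁, h₃, h₄, h₅, hoff, hlists, h, fun j _ => rfl⟩
  obtain ⟨hτ, e₀, e₁, -, -, -, a₀, a₁, hs', hord⟩ := h'
  exact ⟨s', t + 1, he, by omega, e₀, e₁, a₀, a₁, hs', hord⟩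

theorem exec_roundProgram (hr : Represents off lists nbrs n) (hL : Refinement.IsNumbered nbrs n)
    {s : State} {k : ℕ} (hk : k < n) (h₁ : s.var 1 = k)
    (hoff : s.arr 0 = off) (hlists : s.arr 1 = lists) (h : (view s).BeforeRound nbrs n k) :
    ∃ s' t, Exec roundProgram s s' t ∧ t ≤ 30 * (nbrs (s.arr 2 k)).length + 10 ∧
      s'.var 0 = s.var 0 ∧ s'.var 1 = k + 1 ∧ s'.arr 0 = off ∧ s'.arr 1 = lists ∧
      (view s').BeforeRound nbrs n (k + 1) ∧ ∀ j ≤ k, s'.arr 2 j = s.arr 2 j := by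
  obtain ⟨t₁, ht₁, he₁⟩ := Program.LoopFree.exec (p := visitProgram)
    (by simp [visitProgram, block, Program.LoopFree]) s
  have ht : visitProgram.size = 8 := rfl
  obtain ⟨hview, hvar, hvar3, hvar4, hvar5, harr⟩ := eval_visitProgram s
  have hord : (visitProgram.eval s).arr 2 = s.arr 2 := congrArg Refinement.ord hview
  have hv := h.visit hk
  rw [h₁] at hview hvar3 hvar4
  rw [← hview] at hv
  obtain ⟨s₂, t₂, he₂, ht₂, e₀, e₁, a₀, a₁, h₂, hord₂⟩ := exec_scanLoop hr hL
    (s := visitProgram.eval s) (k := k) (v := s.arr 2 k) (b := (view s).num) hk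
    (by rw [hvar 1 (by simp), h₁]) (by rw [hvar3, hoff]) (by rw [hvar4, hoff]) hvar5
    (by rw [harr 0 (by simp), hoff]) (by rw [harr 1 (by simp), hlists]) (by rw [hord]) hv
  have hordk : s.arr 2 k = (view s₂).ord k := by
    rw [← hord]
    exact (hord₂ k le_rfl).symm
  rw [hordk] at h₂
  refine ⟨s₂.setVar 1 (s₂.var 1 + 1), t₁ + (t₂ + 1), he₁.seq (he₂.seq (.succ s₂ 1 1)),
    by omega, ?_, ?_, a₀, a₁, ?_, ?_⟩
  · rw [← hvar 0 (by simp), ← e₀]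
    simp [State.setVar]
  · simp [State.setVar, e₁]
  · have : view (s₂.setVar 1 (s₂.var 1 + 1)) = view s₂ := by simp [view, State.setVar]
    rw [this]
    exact h₂.beforeRound
  · intro j hj
    exact (hord₂ j hj).trans (by rw [hord])

/-- The cost of a round depends on the vertex visited. The sum can be read off the final order
because later rounds leave the visited positions unchanged. -/
theorem exec_roundLoop (hr : Represents off lists nbrs n) (hL : Refinement.IsNumbered nbrs n)
    {s : State} (h₀ : s.var 0 = n) (h₁ : s.var 1 = 0)
    (hoff : s.arr 0 = off) (hlists : s.arr 1 = lists) (h : (view s).BeforeRound nbrs n 0) :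
    ∃ s' t, Exec (.loop (.lt 1 0) roundProgram) s s' (t + 1) ∧
      t ≤ ∑ j ∈ Finset.range n, (30 * (nbrs (s'.arr 2 j)).length + 11) ∧
      (view s').BeforeRound nbrs n n := by
  obtain ⟨s', t, he, h'⟩ := exec_loop (b := .lt 1 0) (p := roundProgram) (N := n)
    (I := fun k s' τ => τ ≤ ∑ j ∈ Finset.range k, (30 * (nbrs (s'.arr 2 j)).length + 11) ∧
      s'.var 0 = n ∧ s'.var 1 = k ∧ s'.arr 0 = off ∧ s'.arr 1 = lists ∧
      (view s').BeforeRound nbrs n k)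
    (by
      rintro k hk s₁ τ ⟨hτ, e₀, e₁, a₀, a₁, hs⟩
      have hb : (Test.lt 1 0).Holds s₁ := by
        simp only [Test.Holds]
        omega
      obtain ⟨s₂, t, he, ht, e₀', e₁', a₀', a₁', hs', hord⟩ :=
        exec_roundProgram hr hL hk e₁ a₀ a₁ hs
      refine ⟨hb, s₂, t, he, ?_, e₀'.trans e₀, e₁', a₀', a₁', hs'⟩
      have hsum : ∑ j ∈ Finset.range k, (30 * (nbrs (s₂.arr 2 j)).length + 11) =
          ∑ j ∈ Finset.range k, (30 * (nbrs (s₁.arr 2 j)).length + 11) :=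
        Finset.sum_congr rfl fun j hj => by rw [hord j (Finset.mem_range.1 hj).le]
      rw [Finset.sum_range_succ, hsum, hord k le_rfl]
      omega)
    (by
      rintro s' τ ⟨-, e₀, e₁, -⟩ hb
      simp only [Test.Holds] at hb
      omega)
    (s := s) (τ := 0) ⟨by simp, h₀, h₁, hoff, hlists, h⟩
  obtain ⟨hτ, -, -, -, -, hs'⟩ := h'
  exact ⟨s', t, he, by rwa [Nat.zero_add] at hτ, hs'⟩

theorem exec_initLoop {s : State} (h₀ : s.var 0 = n) (h₁ : s.var 1 = 0) :
    ∃ s', ∃ t ≤ 4 * n + 1, Exec (.loop (.lt 1 0) initProgram) s s' t ∧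
      s'.var 0 = n ∧ (∀ i < n, s'.arr 2 i = i) ∧ (∀ i < n, s'.arr 3 i = i) ∧
      ∀ a, a ≠ 2 → a ≠ 3 → s'.arr a = s.arr a := by
  obtain ⟨s', t, he, hτ, e₀, -, hs⟩ := exec_loop (b := .lt 1 0) (p := initProgram) (N := n)
    (I := fun k s' τ => τ ≤ 4 * k ∧ s'.var 0 = n ∧ s'.var 1 = k ∧
      (∀ i < k, s'.arr 2 i = i) ∧ (∀ i < k, s'.arr 3 i = i) ∧
      ∀ a, a ≠ 2 → a ≠ 3 → s'.arr a = s.arr a)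
    (by
      rintro k hk s₁ τ ⟨hτ, e₀, e₁, o, p, a⟩
      have hb : (Test.lt 1 0).Holds s₁ := by
        simp only [Test.Holds]
        omega
      obtain ⟨t, ht, he⟩ := Program.LoopFree.exec (p := initProgram)
        (by simp [initProgram, block, Program.LoopFree]) s₁
      have ht' : initProgram.size = 3 := rfl
      refine ⟨hb, _, t, he, by omega, ?_⟩
      rw [eval_initProgram, e₁]
      refine ⟨by simpa [State.setVar, State.setArr] using e₀, by simp [State.setVar], ?_, ?_, ?_⟩
      · intro i hi
        by_cases hik : i = k
        · simp [State.setVar, State.setArr, hik]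
        · simpa [State.setVar, State.setArr, hik] using o i (by omega)
      · intro i hi
        by_cases hik : i = k
        · simp [State.setVar, State.setArr, hik]
        · simpa [State.setVar, State.setArr, hik] using p i (by omega)
      · intro c h₂ h₃
        simpa [State.setVar, State.setArr, h₂, h₃] using a c h₂ h₃)
    (by
      rintro s' τ ⟨-, e₀, e₁, -⟩ hb
      simp only [Test.Holds] at hb
      omega)
    (s := s) (τ := 0)
    ⟨le_rfl, h₀, h₁, fun i hi => absurd hi (Nat.not_lt_zero i),
      fun i hi => absurd hi (Nat.not_lt_zero i), fun _ _ _ => rfl⟩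
  exact ⟨s', t + 1, by omega, he, e₀, hs⟩

theorem exec_lexBFSProgram (hL : Refinement.IsNumbered nbrs n) {s : State} (h₀ : s.var 0 = n)
    (h₁ : s.var 1 = 0) (hr : Represents (s.arr 0) (s.arr 1) nbrs n)
    (hz : ∀ a, 4 ≤ a → ∀ i, s.arr a i = 0) :
    ∃ s' t, Exec lexBFSProgram s s' t ∧
      t ≤ 30 * (∑ a ∈ Finset.range n, (nbrs a).length) + 15 * n + 4 ∧
      (view s').BeforeRound nbrs n n := by
  obtain ⟨s₁, t₁, ht₁, he₁, e₀, o, p, a⟩ := exec_initLoop h₀ h₁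
  have he₂ : Exec (block [.const 1 0, .const 6 1]) s₁ ((s₁.setVar 1 0).setVar 6 1) 2 :=
    (Exec.const s₁ 1 0).seq (Exec.const (s₁.setVar 1 0) 6 1)
  have hB : (view ((s₁.setVar 1 0).setVar 6 1)).BeforeRound nbrs n 0 := by
    refine Refinement.BeforeRound.of_initial o p ?_ ?_ ?_ ?_
    · intro i
      exact (congrFun (a 4 (by decide) (by decide)) i).trans (hz 4 (by decide) i)
    · intro i
      exact (congrFun (a 5 (by decide) (by decide)) i).trans (hz 5 (by decide) i)
    · intro i
      exact (congrFun (a 6 (by decide) (by decide)) i).trans (hz 6 (by decide) i)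
    · simp [view, State.setVar]
  obtain ⟨s₃, t₃, he₃, ht₃, h⟩ := exec_roundLoop hr hL (s := (s₁.setVar 1 0).setVar 6 1)
    (by simpa [State.setVar] using e₀) (by simp [State.setVar])
    (a 0 (by decide) (by decide)) (a 1 (by decide) (by decide)) hB
  refine ⟨s₃, _, he₁.seq (he₂.seq he₃), ?_, h⟩
  -- The final order is a permutation with inverse `s₃.arr 3`, so every list is scanned exactly
  -- once.
  have hsum : ∑ j ∈ Finset.range n, (nbrs (s₃.arr 2 j)).length =
      ∑ a ∈ Finset.range n, (nbrs a).length := by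
    refine Finset.sum_nbij' (s₃.arr 2) (s₃.arr 3) ?_ ?_ ?_ ?_ ?_
    · exact fun i hi => Finset.mem_range.2 (h.ord_lt i (Finset.mem_range.1 hi))
    · exact fun i hi => Finset.mem_range.2 (h.pos_lt i (Finset.mem_range.1 hi))
    · exact fun i hi => h.pos_ord i (Finset.mem_range.1 hi)
    · exact fun i hi => h.ord_pos i (Finset.mem_range.1 hi)
    · exact fun i _ => rfl
  rw [Finset.sum_add_distrib, ← Finset.mul_sum, hsum, Finset.sum_const, Finset.card_range,
    smul_eq_mul] at ht₃
  omega

end Programs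

/-! ### From numbered lists back to the graph. -/

section Correctness

variable {V : Type*} [Fintype V] {G : SimpleGraph V} {e : Ordering V} {L : V → List V}

/-- The list of the vertex number `a`. -/
def numberedList (e : Ordering V) (L : V → List V) (a : ℕ) : List ℕ :=
  (numberedLists e L).getD a []

theorem numberedList_apply {a : ℕ} (ha : a < Fintype.card V) :
    numberedList e L a = (L (e.symm ⟨a, ha⟩)).map fun w => (e w : ℕ) := by
  simp [numberedList, numberedLists, List.getD_eq_getElem?_getD, ha]

theorem IsAdjacencyLists.mem_numberedList (hL : IsAdjacencyLists G L) {a : ℕ}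
    (ha : a < Fintype.card V) {w : V} :
    (e w : ℕ) ∈ numberedList e L a ↔ G.Adj (e.symm ⟨a, ha⟩) w := by
  rw [numberedList_apply ha, List.mem_map, ← (hL (e.symm ⟨a, ha⟩)).2]
  constructor
  · rintro ⟨u, hu, h⟩
    rwa [← e.injective (Fin.ext h)]
  · exact fun h => ⟨w, h, rfl⟩

theorem IsAdjacencyLists.isNumbered (hL : IsAdjacencyLists G L) :
    Refinement.IsNumbered (numberedList e L) (Fintype.card V) := by
  intro a ha
  rw [numberedList_apply ha]
  refine ⟨(hL _).1.map fun u v h => e.injective (Fin.ext h), fun w hw => ?_⟩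
  obtain ⟨u, -, rfl⟩ := List.mem_map.1 hw
  exact (e u).2

theorem represents_inputState (e : Ordering V) (L : V → List V) :
    Represents ((inputState e L).arr 0) ((inputState e L).arr 1) (numberedList e L)
      (Fintype.card V) := by
  intro a ha
  have hlen : (numberedLists e L).length = Fintype.card V := by simp [numberedLists]
  have ha' : a < (numberedLists e L).length := hlen ▸ ha
  have hget : numberedList e L a = (numberedLists e L)[a] := by
    simp [numberedList, List.getD_eq_getElem?_getD, ha']
  have h₀ : (inputState e L).arr 0 a = ((numberedLists e L).take a).flatten.length := by
    simp [inputState, ha.le]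
  have h₁ : (inputState e L).arr 0 (a + 1) =
      ((numberedLists e L).take (a + 1)).flatten.length := by
    simp only [inputState, if_true, if_pos (show a + 1 ≤ Fintype.card V from ha)]
  constructor
  · rw [h₀, h₁, hget, List.take_succ_eq_append_getElem ha', List.flatten_append,
      List.length_append, List.flatten_singleton]
  · intro i hi
    have h₂ : (inputState e L).arr 1 = fun i => (numberedLists e L).flatten.getD i 0 := rfl
    have h₃ : (numberedLists e L).flatten = ((numberedLists e L).take a).flatten ++
        (numberedList e L a ++ ((numberedLists e L).drop (a + 1)).flatten) := by
      conv_lhs => rw [← List.take_append_drop a (numberedLists e L),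
        List.drop_eq_getElem_cons ha', List.flatten_append, List.flatten_cons]
      rw [hget]
    simp only [h₂]
    rw [h₀, h₃, List.getD_append_right _ _ _ _ (Nat.le_add_right _ _), Nat.add_sub_cancel_left,
      List.getD_append _ _ _ _ hi, List.getD_eq_getElem _ _ hi]

theorem IsAdjacencyLists.sum_length (hL : IsAdjacencyLists G L) :
    ∑ a ∈ Finset.range (Fintype.card V), (numberedList e L a).length =
      2 * G.edgeSet.ncard := by
  classical
  have h₁ : ∀ v, (L v).length = G.degree v := by
    intro v
    rw [← List.toFinset_card_of_nodup (hL v).1, ← SimpleGraph.card_neighborFinset_eq_degree]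
    congr 1
    ext w
    simp [(hL v).2]
  rw [← SimpleGraph.coe_edgeFinset, Set.ncard_coe_finset,
    ← SimpleGraph.sum_degrees_eq_twice_card_edges, Finset.sum_range, ← e.symm.sum_comp]
  refine Finset.sum_congr rfl fun i _ => ?_
  rw [numberedList_apply i.2, List.length_map, h₁]

theorem IsAdjacencyLists.exists_lexBFS (hL : IsAdjacencyLists G L) :
    ∃ φ : Ordering V, IsLexBFSOrdering G φ ∧
      ComputesWithin lexBFSProgram e L φ (60 * (Fintype.card V + G.edgeSet.ncard + 1)) ∧
      (Refinement.IsPresorted (numberedList e L) (Fintype.card V) → φ = e) := by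
  obtain ⟨s, t, he, ht, h⟩ := exec_lexBFSProgram (hL.isNumbered (e := e)) (s := inputState e L)
    rfl rfl (represents_inputState e L) (by
      intro a ha i
      simp only [inputState]
      rw [if_neg (by omega), if_neg (by omega)])
  rw [hL.sum_length] at ht
  let φ : Ordering V :=
    { toFun := fun v => ⟨s.arr 3 (e v), h.pos_lt _ (e v).2⟩
      invFun := fun i => e.symm ⟨s.arr 2 i, h.ord_lt _ i.2⟩
      left_inv := fun v => by
        have : s.arr 2 (s.arr 3 (e v)) = e v := h.ord_pos _ (e v).2
        simp [this]
      right_inv := fun i => by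
        have : s.arr 3 (s.arr 2 i) = i := h.pos_ord _ i.2
        simp [this] }
  have hsymm : ∀ i : Fin (Fintype.card V), s.arr 2 i = e (φ.symm i) := fun i => by
    change s.arr 2 i = e (e.symm ⟨s.arr 2 i, h.ord_lt _ i.2⟩)
    rw [Equiv.apply_symm_apply]
  have hφ : ∀ v, (φ v : ℕ) = s.arr 3 (e v) := fun v => rfl
  refine ⟨φ, ?_, ⟨s, t, he, by omega, hsymm⟩, fun hs => ?_⟩
  · rw [isLexBFSOrdering_iff]
    have hval : ∀ i ≤ Fintype.card V, ∀ w : V, lexValue (adjAt G φ) i w =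
        lexValue ((view s).listed (numberedList e L)) i (e w) := by
      intro i hi w
      refine lexValue_congr fun j hj => ?_
      have hj' : j < Fintype.card V := hj.trans_le hi
      have hsj : (view s).ord j = (e (φ.symm ⟨j, hj'⟩) : ℕ) := hsymm ⟨j, hj'⟩
      rw [Refinement.listed, hsj, hL.mem_numberedList (e _).2]
      simp [adjAt, hj']
    intro v w hvw
    rw [hval _ (φ v).2.le, hval _ (φ v).2.le]
    have := h.lexBFS (φ v) (φ v).2 (e w) (e w).2 hvw
    rwa [show (view s).ord (φ v) = e v from h.ord_pos _ (e v).2] at this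
  · refine Equiv.symm_bijective.injective (Equiv.ext fun i => e.injective (Fin.ext ?_))
    rw [← hsymm, Equiv.apply_symm_apply]
    exact h.ident hs i i.2

open Classical in
/-- The neighbours of each vertex in the order `φ`. -/
noncomputable def sortedLists (G : SimpleGraph V) (φ : Ordering V) (v : V) : List V :=
  ((List.finRange (Fintype.card V)).filter fun i => G.Adj v (φ.symm i)).map φ.symm

theorem isAdjacencyLists_sortedLists (φ : Ordering V) :
    IsAdjacencyLists G (sortedLists G φ) := by
  intro v
  constructor
  · exact ((List.nodup_finRange _).filter _).map φ.symm.injective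
  · intro w
    simp only [sortedLists, List.mem_map, List.mem_filter, List.mem_finRange, true_and,
      decide_eq_true_eq]
    constructor
    · rintro ⟨i, h, rfl⟩
      exact h
    · exact fun h => ⟨φ w, by simpa using h, by simp⟩

/-- This makes the program reproduce `φ` when `φ` itself is the numbering and the lists are sorted
by it. -/
theorem IsLexBFSOrdering.isPresorted {φ : Ordering V} (h : IsLexBFSOrdering G φ) :
    Refinement.IsPresorted (numberedList φ (sortedLists G φ)) (Fintype.card V) := by
  constructor
  · intro a ha
    rw [numberedList_apply ha, sortedLists, List.map_map, List.pairwise_map]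
    refine ((List.pairwise_lt_finRange _).filter _).imp fun {i j} hij => ?_
    simpa using hij
  · intro i hi a ha hia
    rw [isLexBFSOrdering_iff] at h
    have hval : ∀ u : Fin (Fintype.card V), lexValue (adjAt G φ) i (φ.symm u) =
        lexValue (fun j u => u ∈ numberedList φ (sortedLists G φ) j) i (u : ℕ) := by
      intro u
      refine lexValue_congr fun j hj => ?_
      have hj' : j < Fintype.card V := hj.trans hi
      have := (isAdjacencyLists_sortedLists (G := G) φ).mem_numberedList (e := φ) hj'
        (w := φ.symm u)
      rw [Equiv.apply_symm_apply] at this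
      rw [this]
      simp [adjAt, hj']
    have := h (φ.symm ⟨i, hi⟩) (φ.symm ⟨a, ha⟩) (by simpa using hia)
    rw [Equiv.apply_symm_apply] at this
    rw [hval ⟨i, hi⟩, hval ⟨a, ha⟩] at this
    exact this

end Correctness

end ModuleComposed

theorem mainTheorem11 :
    ∃ (p : ModuleComposed.Program) (c : ℕ),
      ∀ (V : Type*) [Fintype V] (G : SimpleGraph V),
        ModuleComposed.IsIndependentModuleComposed G →
          (∀ φ : ModuleComposed.Ordering V, ModuleComposed.IsLexBFSOrdering G φ →
            ModuleComposed.IsIndependentModuleSequence G φ) ∧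
          (∀ (e : ModuleComposed.Ordering V) (L : V → List V),
            ModuleComposed.IsAdjacencyLists G L →
              ∃ φ : ModuleComposed.Ordering V, ModuleComposed.IsLexBFSOrdering G φ ∧
                ModuleComposed.ComputesWithin p e L φ
                  (c * (Fintype.card V + G.edgeSet.ncard + 1))) ∧
          (∀ φ : ModuleComposed.Ordering V, ModuleComposed.IsLexBFSOrdering G φ →
            ∃ (e : ModuleComposed.Ordering V) (L : V → List V),
              ModuleComposed.IsAdjacencyLists G L ∧
                ModuleComposed.ComputesWithin p e L φ
                  (c * (Fintype.card V + G.edgeSet.ncard + 1))) := by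
  -- Each list entry costs at most 30 steps and each edge occurs in two lists, hence 60; the `15 * n
  -- + 4` other steps fit as well.
  refine ⟨ModuleComposed.lexBFSProgram, 60, fun V _ G hG =>
    ⟨fun φ hφ => hG.isIndependentModuleSequence hφ, fun e L hL => ?_, fun φ hφ => ?_⟩⟩
  · obtain ⟨φ, hφ, hc, -⟩ := hL.exists_lexBFS (e := e)
    exact ⟨φ, hφ, hc⟩
  · have hL := ModuleComposed.isAdjacencyLists_sortedLists (G := G) φ
    obtain ⟨ψ, -, hc, he⟩ := hL.exists_lexBFS (e := φ)
    rw [he hφ.isPresorted] at hc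
    exact ⟨φ, _, hL, hc⟩
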